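/- Let $d=2^N$, the dimension of the Hilbert space of $N$ qubits. A probability law on pure states $\rho=|\psi\rangle\langle\psi|$ is a \emph{state 2-design} if $\mathbb E[\rho\otimes\rho]=\Pi_{\rm sym}/\binom{d+1}{2}$, where $\Pi_{\rm sym}=\frac12(I+\mathrm{SWAP})$ (the value for Haar-random states). Let $\mathcal A=\{(\rho_a,y_a)\}$ and $\mathcal B=\{(\rho_b,y_b)\}$ be a training and a test set of $n=|\mathcal A|\ge1$ and $m=|\mathcal B|\ge1$ mutually independent samples, where every $\rho_a$ and $\rho_b$ is a pure $N$-qubit state whose law is a state 2-design, the labels are real with finite second moments (they may be constants, or depend on the state of their own sample), and $n<2^{N/2}$. The quantum kernel method predicts $z_\theta(\rho)=\sum_{a\in\mathcal A}\theta_a\,\mathrm{Tr}[\rho_a\rho]$, $\theta\in\mathbb R^n$. Its losses are $\mathcal L_{\mathcal A}(\theta)=\frac1{2n}\sum_{a\in\mathcal A}(z_\theta(\rho_a)-y_a)^2$ and $\mathcal L_{\mathcal B}(\theta)=\frac1{2m}\sum_{b\in\mathcal B}(z_\theta(\rho_b)-y_b)^2$. Fix an initial parameter $\theta(0)\in\mathbb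 R^n$, and let $\theta(\infty)$, a function of the training set, be a parameter with zero training loss whenever one exists. Write $\mathcal L(0)=\mathcal L(\theta(0))$, $\mathcal L(\infty)=\mathcal L(\theta(\infty))$, $k=(\mathrm{Tr}[\rho_a\rho_{a'}])_{a,a'\in\mathcal A}$, and $$M=\frac1n\sum_{a}\theta_a(0)^2+\frac1n\sum_{a}\mathbb E\,y_a^2+\frac1m\sum_{b}\mathbb E\,y_b^2 .$$ There is an absolute constant $C>0$ such that in every such situation the following hold. (1) With probability at least $1-C(n/2^N)^2$ the matrix $k$ is invertible, $\theta(\infty)=k^{-1}y_{\mathcal A}$ and $\mathcal L_{\mathcal A}(\infty)=0$. (2) $\mathcal L_{\mathcal B}(0)$ and $\sqrt{\mathcal L_{\mathcal A}(0)\mathcal L_{\mathcal B}(0)}$ are integrable and, with expectations over $\mathcal A$ and $\mathcal B$ (the left side may be $+\infty$, and is a lower integral if it is not measurable), $$\mathbb E\,\mathcal L_{\mathcal B}(\infty)\;\ge\;\mathbb E\,\mathcal L_{\mathcal B}(0)-\frac{|\mathcal A|}{2^{N-1}}\,\mathbb E\sqrt{\mathcal L_{\mathcal A}(0)\mathcal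 L_{\mathcal B}(0)}-C\Big(\frac{|\mathcal A|}{2^N}\Big)^2M .$$ (3) For every $p>0$, with probability at least $1-p$ over the training set, with expectations over the test set, $$\mathbb E_{\mathcal B}\,\mathcal L_{\mathcal B}(\infty)\;\ge\;\mathbb E_{\mathcal B}\,\mathcal L_{\mathcal B}(0)-\frac{|\mathcal A|}{2^{N-1}}\,\mathbb E_{\mathcal B}\sqrt{\mathcal L_{\mathcal A}(0)\mathcal L_{\mathcal B}(0)}-\frac Cp\Big(\frac{|\mathcal A|}{2^N}\Big)^2M .$$ -/

import Mathlib

open MeasureTheory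
open scoped Matrix Kronecker

noncomputable section

namespace QKM

/-- Labels of the computational basis of `N` qubits; the Hilbert space has dimension `2 ^ N`. -/
abbrev Basis (N : ℕ) : Type := Fin N → Fin 2

/-- Pure `N`-qubit state vectors: unit vectors of `(ℂ²)^{⊗ N}`. -/
abbrev PureState (N : ℕ) : Type :=
  Metric.sphere (0 : EuclideanSpace ℂ (Basis N)) 1

/-- The density matrix `ρ = |ψ⟩⟨ψ|`. -/
def density {N : ℕ} (ψ : PureState N) : Matrix (Basis N) (Basis N) ℂ :=
  Matrix.of fun i j => ψ.1 i * star (ψ.1 j)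

/-- The operator exchanging the two tensor factors. -/
def swapMatrix (N : ℕ) : Matrix (Basis N × Basis N) (Basis N × Basis N) ℂ :=
  Matrix.of fun p q => if p.1 = q.2 ∧ p.2 = q.1 then 1 else 0

/-- The orthogonal projection onto the symmetric subspace of two copies of the Hilbert space. -/
def symProjection (N : ℕ) : Matrix (Basis N × Basis N) (Basis N × Basis N) ℂ :=
  (1 / 2 : ℂ) • (1 + swapMatrix N)

/-- The two-copy average `𝔼 [ρ ⊗ ρ]` of a random pure state, entry by entry. -/
def twoCopyMoment {N : ℕ} (μ : Measure (PureState N)) :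
    Matrix (Basis N × Basis N) (Basis N × Basis N) ℂ :=
  Matrix.of fun p q => ∫ ψ, (density ψ ⊗ₖ density ψ) p q ∂μ

/-- A probability law on pure states is a state 2-design if `𝔼 [ρ ⊗ ρ]` is the normalized
projection onto the symmetric subspace, whose dimension is `d (d + 1) / 2` with `d = 2 ^ N`
(this is the two-copy average of a Haar random state). -/
def IsStateTwoDesign {N : ℕ} (μ : Measure (PureState N)) : Prop :=
  IsProbabilityMeasure μ ∧
    twoCopyMoment μ = ((Nat.choose (2 ^ N + 1) 2 : ℂ))⁻¹ • symProjection N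

/-- A labelled sample `(ρ, y)`. -/
abbrev Sample (N : ℕ) : Type := PureState N × ℝ

/-- The quantum kernel `k(ρ, ρ') = Tr[ρ ρ']` (a real number). -/
def kernel {N : ℕ} (ψ φ : PureState N) : ℝ := (density ψ * density φ).trace.re

/-- The kernel matrix of a training set. -/
def kernelMatrix {N n : ℕ} (S : Fin n → Sample N) : Matrix (Fin n) (Fin n) ℝ :=
  Matrix.of fun a a' => kernel (S a).1 (S a').1

/-- The observable `O(θ) = ∑ a, θ_a ρ_a` of the quantum kernel method with training set `S`. -/
def observable {N n : ℕ} (S : Fin n → Sample N) (θ : Fin n → ℝ) :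
    Matrix (Basis N) (Basis N) ℂ :=
  ∑ a, (θ a : ℂ) • density (S a).1

/-- The prediction `Tr[O(θ) ρ]` (a real number). -/
def prediction {N n : ℕ} (S : Fin n → Sample N) (θ : Fin n → ℝ) (ψ : PureState N) : ℝ :=
  (observable S θ * density ψ).trace.re

/-- The mean squared loss on the data set `D` of the model with training set `S` and
parameter `θ`. -/
def loss {N n m : ℕ} (S : Fin n → Sample N) (θ : Fin n → ℝ) (D : Fin m → Sample N) : ℝ :=
  (1 / (2 * (m : ℝ))) * ∑ i, (prediction S θ (D i).1 - (D i).2) ^ 2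

/-- The loss on the training set itself. -/
def trainLoss {N n : ℕ} (S : Fin n → Sample N) (θ : Fin n → ℝ) : ℝ := loss S θ S

/-- Mean square size of the initial parameter, the training labels and the test labels. -/
def meanSquareScale {N n m : ℕ} (θ₀ : Fin n → ℝ) (P : Fin n → Measure (Sample N))
    (Q : Fin m → Measure (Sample N)) : ℝ :=
  (∑ a, θ₀ a ^ 2) / n + (∑ a, ∫ s, s.2 ^ 2 ∂(P a)) / n + (∑ b, ∫ s, s.2 ^ 2 ∂(Q b)) / m

end QKM

end

/-!
Let `d = 2 ^ N`, let `k` be the kernel matrix of the training set, and let `r = k θ₀ - y` be the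
training residuals of the initial model.

Since the laws are 2-designs, the centred kernel `h(ψ, φ) = Tr[ψ φ] - 1 / d` has mean zero and
satisfies `𝔼_φ h(ψ, φ) h(ψ', φ) = h(ψ, ψ') / (d (d + 1))` (`integral_centredKernel_mul`). Hence
`ε = ‖k - 1‖²` (Frobenius norm) has expectation at most `2 (n / d)²`. Whenever `ε < 1 / 4` the
matrix `k` is invertible, and the trained parameter is forced to be
`k⁻¹ y = θ₀ - r + δ` with `δ` of size `√ε ‖r‖`.

By convexity of the square, the expected test loss changes by at least the correlation of the
initial test error `e` with the change of the prediction. The mean part of that change is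
`- ∑ r / d`, and its correlation with `e` is bounded by the term
`2 (n / d) √(L_A L_B)` by Cauchy–Schwarz. Everything else is of second order
(`integral_error_sq_ge_of_interpolates`). The critical contribution is the correlation of the
test label with the centred prediction: for a single training state it is
`g(φ) = 𝔼 [y h(φ, ρ)]`. Because `𝔼 g²` depends on the law of `φ` only through its second moment,
one may compute it with `φ` distributed as the test state itself; the reproducing property of `h`
and Cauchy–Schwarz then give `𝔼 g² ≤ 𝔼 y² / (d (d + 1))²` (`integral_labelOverlap_sq_le`).

All errors are collected in an explicit nonnegative function `remainder` of the training set. It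
also exceeds the initial test loss when `ε ≥ 1 / 4`, so that no control over the trained
parameter is needed there. Its expectation is at most `64 (n / d)² M` (`integral_remainder_le`).
Integrating gives the bound in expectation, and Markov's inequality the one with high probability.
-/

namespace QKM

variable {N n m : ℕ}

/-! ### The quantum kernel -/

lemma trace_density_mul_density (ψ φ : PureState N) :
    (density ψ * density φ).trace = ((‖inner ℂ ψ.1 φ.1‖ ^ 2 : ℝ) : ℂ) := by
  have h : (density ψ * density φ).trace
      = inner ℂ ψ.1 φ.1 * (starRingEnd ℂ) (inner ℂ ψ.1 φ.1) := by
    simp only [Matrix.trace, Matrix.diag, Matrix.mul_apply, density, Matrix.of_apply,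
      PiLp.inner_apply, RCLike.inner_apply, map_sum, map_mul, Complex.conj_conj,
      Finset.sum_mul_sum]
    rw [Finset.sum_comm]
    refine Finset.sum_congr rfl fun i _ => Finset.sum_congr rfl fun j _ => ?_
    simp only [RCLike.star_def]
    ring
  rw [h, Complex.mul_conj, Complex.normSq_eq_norm_sq]

lemma kernel_eq (ψ φ : PureState N) : kernel ψ φ = ‖inner ℂ ψ.1 φ.1‖ ^ 2 := by
  rw [kernel, trace_density_mul_density, Complex.ofReal_re]

lemma ofReal_kernel (ψ φ : PureState N) :
    (kernel ψ φ : ℂ) = (density ψ * density φ).trace := by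
  rw [kernel_eq, trace_density_mul_density]

lemma kernel_nonneg (ψ φ : PureState N) : 0 ≤ kernel ψ φ := by
  rw [kernel_eq]; positivity

lemma kernel_le_one (ψ φ : PureState N) : kernel ψ φ ≤ 1 := by
  rw [kernel_eq]
  have h := norm_inner_le_norm (𝕜 := ℂ) ψ.1 φ.1
  rw [norm_eq_of_mem_sphere ψ, norm_eq_of_mem_sphere φ, one_mul] at h
  exact pow_le_one₀ (norm_nonneg _) h

lemma kernel_comm (ψ φ : PureState N) : kernel ψ φ = kernel φ ψ := by
  rw [kernel_eq, kernel_eq, norm_inner_symm]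

lemma kernel_self (ψ : PureState N) : kernel ψ ψ = 1 := by
  rw [kernel_eq, inner_self_eq_norm_sq_to_K, norm_eq_of_mem_sphere ψ]
  simp

@[fun_prop]
lemma continuous_kernel {X : Type*} [TopologicalSpace X] {f g : X → PureState N}
    (hf : Continuous f) (hg : Continuous g) : Continuous fun x => kernel (f x) (g x) := by
  simp only [kernel_eq]
  exact ((continuous_subtype_val.comp hf).inner (continuous_subtype_val.comp hg)).norm.pow 2

lemma trace_density (ψ : PureState N) : (density ψ).trace = 1 := by
  have h : (density ψ).trace = inner ℂ ψ.1 ψ.1 := by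
    simp only [Matrix.trace, Matrix.diag, density, Matrix.of_apply, PiLp.inner_apply,
      RCLike.inner_apply, RCLike.star_def]
  rw [h, inner_self_eq_norm_sq_to_K, norm_eq_of_mem_sphere ψ]
  simp

/-! ### Second moments of a state 2-design -/

lemma trace_kronecker_mul_swapMatrix (A B : Matrix (Basis N) (Basis N) ℂ) :
    ((A ⊗ₖ B) * swapMatrix N).trace = (A * B).trace := by
  simp only [Matrix.trace, Matrix.diag, Matrix.mul_apply, swapMatrix, Matrix.of_apply,
    Matrix.kroneckerMap_apply, Fintype.sum_prod_type, mul_ite, mul_one, mul_zero, ite_and]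
  refine Finset.sum_congr rfl fun i _ => Finset.sum_congr rfl fun j _ => ?_
  simp

lemma integrable_twoCopy (μ : Measure (PureState N)) [IsFiniteMeasure μ]
    (p q : Basis N × Basis N) :
    Integrable (fun φ => (density φ ⊗ₖ density φ) p q) μ := by
  have hb : ∀ (φ : PureState N) (i : Basis N), ‖φ.1 i‖ ≤ 1 := fun φ i =>
    (PiLp.norm_apply_le φ.1 i).trans (norm_eq_of_mem_sphere φ).le
  refine Integrable.of_bound (C := 1) (Continuous.aestronglyMeasurable ?_)
    (Filter.Eventually.of_forall fun φ => ?_)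
  · simp only [Matrix.kroneckerMap_apply, density, Matrix.of_apply]
    fun_prop
  · simp only [Matrix.kroneckerMap_apply, density, Matrix.of_apply, norm_mul, norm_star]
    have h := hb φ
    have h0 := fun i => norm_nonneg (φ.1 i)
    exact mul_le_one₀ (mul_le_one₀ (h _) (h0 _) (h _)) (by positivity)
      (mul_le_one₀ (h _) (h0 _) (h _))

lemma integral_trace_mul_twoCopy (μ : Measure (PureState N)) [IsFiniteMeasure μ]
    (A : Matrix (Basis N × Basis N) (Basis N × Basis N) ℂ) :
    ∫ φ, (A * (density φ ⊗ₖ density φ)).trace ∂μ = (A * twoCopyMoment μ).trace := by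
  simp only [Matrix.trace, Matrix.diag, Matrix.mul_apply]
  rw [integral_finsetSum _ fun p _ => integrable_finsetSum _ fun q _ =>
    (integrable_twoCopy μ q p).const_mul (A p q)]
  refine Finset.sum_congr rfl fun p _ => ?_
  rw [integral_finsetSum _ fun q _ => (integrable_twoCopy μ q p).const_mul (A p q)]
  refine Finset.sum_congr rfl fun q _ => ?_
  rw [integral_const_mul]
  rfl

lemma integral_kernel_mul_kernel {μ : Measure (PureState N)} (hμ : IsStateTwoDesign μ)
    (ψ ψ' : PureState N) :
    ∫ φ, kernel ψ φ * kernel ψ' φ ∂μ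
      = (1 + kernel ψ ψ') / ((2 : ℝ) ^ N * (2 ^ N + 1)) := by
  obtain ⟨hp, hm⟩ := hμ
  have h2 : ((∫ φ, kernel ψ φ * kernel ψ' φ ∂μ : ℝ) : ℂ)
      = ((density ψ ⊗ₖ density ψ') * twoCopyMoment μ).trace := by
    rw [← integral_trace_mul_twoCopy, ← integral_complex_ofReal]
    refine integral_congr_ae (Filter.Eventually.of_forall fun φ => ?_)
    simp only
    rw [Complex.ofReal_mul, ofReal_kernel, ofReal_kernel, ← Matrix.trace_kronecker,
      Matrix.mul_kronecker_mul]
  have hch : ((Nat.choose (2 ^ N + 1) 2 : ℕ) : ℂ) = (2 ^ N + 1) * 2 ^ N / 2 := by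
    rw [Nat.cast_choose_two]; push_cast; ring
  rw [hm, hch, symProjection, Matrix.mul_smul, Matrix.mul_smul, Matrix.trace_smul,
    Matrix.trace_smul, mul_add, Matrix.trace_add, mul_one, trace_kronecker_mul_swapMatrix,
    Matrix.trace_kronecker, trace_density, trace_density, ← ofReal_kernel] at h2
  have h3 : (2 : ℂ) ^ N + 1 ≠ 0 := by exact_mod_cast (Nat.succ_ne_zero (2 ^ N))
  apply Complex.ofReal_injective
  rw [h2]
  push_cast
  simp only [smul_eq_mul]
  field_simp

/-- The `j`-th computational basis state. -/
noncomputable def basisState (j : Basis N) : PureState N :=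
  ⟨EuclideanSpace.single j 1, by simp⟩

lemma sum_kernel_basisState (φ : PureState N) : ∑ j, kernel (basisState j) φ = 1 := by
  have h := EuclideanSpace.norm_sq_eq φ.1
  rw [norm_eq_of_mem_sphere φ] at h
  simp only [kernel_eq, basisState, EuclideanSpace.inner_single_left]
  simpa using h.symm

lemma integrable_kernel_mul_kernel (μ : Measure (PureState N)) [IsFiniteMeasure μ]
    (ψ ψ' : PureState N) : Integrable (fun φ => kernel ψ φ * kernel ψ' φ) μ := by
  refine Integrable.of_bound (C := 1) (Continuous.aestronglyMeasurable (by fun_prop))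
    (Filter.Eventually.of_forall fun φ => ?_)
  rw [Real.norm_of_nonneg (mul_nonneg (kernel_nonneg _ _) (kernel_nonneg _ _))]
  exact mul_le_one₀ (kernel_le_one _ _) (kernel_nonneg _ _) (kernel_le_one _ _)

/-- The first moment follows from the second one by resolving the identity in the
computational basis. -/
lemma integral_kernel {μ : Measure (PureState N)} (hμ : IsStateTwoDesign μ)
    (ψ : PureState N) : ∫ φ, kernel ψ φ ∂μ = 1 / (2 : ℝ) ^ N := by
  have := hμ.1
  have h : ∀ φ, kernel ψ φ = ∑ j, kernel ψ φ * kernel (basisState j) φ := fun φ => by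
    rw [← Finset.mul_sum, sum_kernel_basisState, mul_one]
  rw [integral_congr_ae (Filter.Eventually.of_forall h),
    integral_finsetSum _ fun j _ => integrable_kernel_mul_kernel μ _ _]
  simp_rw [integral_kernel_mul_kernel hμ, kernel_comm ψ]
  rw [← Finset.sum_div, Finset.sum_add_distrib, sum_kernel_basisState]
  simp only [Finset.sum_const, Finset.card_univ, Fintype.card_fun, Fintype.card_fin,
    nsmul_eq_mul, mul_one]
  push_cast
  field_simp

/-- The kernel centred at its average over a state 2-design. -/
noncomputable def centredKernel (ψ φ : PureState N) : ℝ := kernel ψ φ - 1 / 2 ^ N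

@[fun_prop]
lemma continuous_centredKernel {X : Type*} [TopologicalSpace X] {f g : X → PureState N}
    (hf : Continuous f) (hg : Continuous g) :
    Continuous fun x => centredKernel (f x) (g x) := by
  unfold centredKernel; fun_prop

lemma centredKernel_comm (ψ φ : PureState N) : centredKernel ψ φ = centredKernel φ ψ := by
  rw [centredKernel, centredKernel, kernel_comm]

lemma abs_centredKernel_le_one (ψ φ : PureState N) : |centredKernel ψ φ| ≤ 1 := by
  have h1 : (1 : ℝ) / 2 ^ N ≤ 1 := by
    rw [div_le_one (by positivity)]; exact one_le_pow₀ (by norm_num)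
  have h2 : (0 : ℝ) ≤ 1 / 2 ^ N := by positivity
  rw [abs_le, centredKernel]
  constructor <;> linarith [kernel_nonneg ψ φ, kernel_le_one ψ φ]

/-- The variance scale `1 / (d (d + 1))` of the centred kernel. -/
noncomputable def designConst (N : ℕ) : ℝ := 1 / ((2 : ℝ) ^ N * (2 ^ N + 1))

lemma designConst_pos (N : ℕ) : 0 < designConst N := by unfold designConst; positivity

lemma designConst_le (N : ℕ) : designConst N ≤ 1 / (2 ^ N) ^ 2 := by
  unfold designConst
  apply one_div_le_one_div_of_le (by positivity)
  nlinarith [show (0 : ℝ) < 2 ^ N by positivity]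

/-- The law of a labelled sample whose state marginal is a state 2-design. -/
def IsDesignSample (Q : Measure (Sample N)) : Prop := IsStateTwoDesign (Q.map Prod.fst)

lemma IsDesignSample.isProbabilityMeasure {Q : Measure (Sample N)} (hQ : IsDesignSample Q) :
    IsProbabilityMeasure Q :=
  have := hQ.1
  Measure.isProbabilityMeasure_of_map Prod.fst

lemma integral_comp_fst {Q : Measure (Sample N)} {f : PureState N → ℝ} (hf : Continuous f) :
    ∫ s, f s.1 ∂Q = ∫ φ, f φ ∂(Q.map Prod.fst) :=
  (integral_map measurable_fst.aemeasurable hf.aestronglyMeasurable).symm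

lemma integral_kernel_sq {Q : Measure (Sample N)} (hQ : IsDesignSample Q) (ψ : PureState N) :
    ∫ s, kernel ψ s.1 ^ 2 ∂Q = 2 * designConst N := by
  rw [integral_comp_fst (f := fun φ => kernel ψ φ ^ 2) (by fun_prop)]
  simp_rw [sq]
  rw [integral_kernel_mul_kernel hQ, kernel_self, designConst]
  ring

/-- The centred kernel reproduces itself, up to the variance scale, when integrated against
a state 2-design. -/
lemma integral_centredKernel_mul {Q : Measure (Sample N)} (hQ : IsDesignSample Q)
    (ψ ψ' : PureState N) :
    ∫ s, centredKernel ψ s.1 * centredKernel ψ' s.1 ∂Q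
      = designConst N * centredKernel ψ ψ' := by
  have := hQ.1
  rw [integral_comp_fst (f := fun φ => centredKernel ψ φ * centredKernel ψ' φ) (by fun_prop)]
  have hk : ∀ χ : PureState N, Integrable (fun φ => kernel χ φ) (Q.map Prod.fst) := fun χ =>
    Integrable.of_bound (C := 1) (Continuous.aestronglyMeasurable (by fun_prop))
      (Filter.Eventually.of_forall fun φ => by
        rw [Real.norm_of_nonneg (kernel_nonneg _ _)]; exact kernel_le_one _ _)
  have h : ∀ φ, centredKernel ψ φ * centredKernel ψ' φ
      = kernel ψ φ * kernel ψ' φ - 1 / 2 ^ N * kernel ψ φ - 1 / 2 ^ N * kernel ψ' φ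
        + 1 / 2 ^ N * (1 / 2 ^ N) := fun φ => by unfold centredKernel; ring
  have hi := integrable_kernel_mul_kernel (Q.map Prod.fst) ψ ψ'
  have h1 := (hk ψ).const_mul (1 / 2 ^ N)
  have h2 := (hk ψ').const_mul (1 / 2 ^ N)
  have hi1 : Integrable (fun φ => kernel ψ φ * kernel ψ' φ - 1 / 2 ^ N * kernel ψ φ)
    (Q.map Prod.fst) := hi.sub h1
  have hi2 : Integrable (fun φ => kernel ψ φ * kernel ψ' φ - 1 / 2 ^ N * kernel ψ φ
    - 1 / 2 ^ N * kernel ψ' φ) (Q.map Prod.fst) := hi1.sub h2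
  simp_rw [h]
  rw [integral_add hi2 (integrable_const _), integral_sub hi1 h2, integral_sub hi h1,
    integral_const_mul, integral_const_mul,
    integral_kernel hQ, integral_kernel hQ, integral_kernel_mul_kernel hQ, integral_const,
    probReal_univ, centredKernel, designConst]
  simp only [smul_eq_mul]
  field_simp
  ring

/-! ### Square-integrable functions of a sample -/

lemma integrable_mul_of_memLp_two {Ω : Type*} [MeasurableSpace Ω] {μ : Measure Ω} {f g : Ω → ℝ}
    (hf : MemLp f 2 μ) (hg : MemLp g 2 μ) : Integrable (fun x => f x * g x) μ :=
  hf.integrable_mul hg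

lemma sq_integral_mul_le {Ω : Type*} [MeasurableSpace Ω] {μ : Measure Ω} {f g : Ω → ℝ}
    (hf : MemLp f 2 μ) (hg : MemLp g 2 μ) :
    (∫ x, f x * g x ∂μ) ^ 2 ≤ (∫ x, f x ^ 2 ∂μ) * ∫ x, g x ^ 2 ∂μ := by
  have h := discrim_le_zero (a := ∫ x, f x ^ 2 ∂μ) (b := 2 * ∫ x, f x * g x ∂μ)
    (c := ∫ x, g x ^ 2 ∂μ) fun t => by
      have h1 : 0 ≤ ∫ x, (t * f x + g x) ^ 2 ∂μ := integral_nonneg fun x => sq_nonneg _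
      have h2 : ∀ x, (t * f x + g x) ^ 2
          = t * t * f x ^ 2 + 2 * t * (f x * g x) + g x ^ 2 := fun x => by ring
      have i1 := hf.integrable_sq.const_mul (t * t)
      have i2 := (integrable_mul_of_memLp_two hf hg).const_mul (2 * t)
      have i12 : Integrable (fun x => t * t * f x ^ 2 + 2 * t * (f x * g x)) μ := i1.add i2
      simp_rw [h2] at h1
      rw [integral_add i12 hg.integrable_sq, integral_add i1 i2, integral_const_mul,
        integral_const_mul] at h1
      linarith
  rw [discrim] at h
  linarith

lemma exists_bound_of_continuous {X : Type*} [TopologicalSpace X] [CompactSpace X] {f : X → ℝ}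
    (hf : Continuous f) : ∃ C, ∀ x, ‖f x‖ ≤ C := by
  obtain ⟨C, hC⟩ := isCompact_univ.exists_bound_of_continuousOn hf.continuousOn
  exact ⟨C, fun x => hC x (Set.mem_univ x)⟩

lemma memLp_comp_fst (Q : Measure (Sample N)) [IsFiniteMeasure Q] {f : PureState N → ℝ}
    (hf : Continuous f) : MemLp (fun s : Sample N => f s.1) 2 Q := by
  obtain ⟨C, hC⟩ := exists_bound_of_continuous hf
  exact MemLp.of_bound (hf.comp continuous_fst).aestronglyMeasurable C
    (Filter.Eventually.of_forall fun s => hC s.1)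

lemma integral_integral_label_mul_swap {P Q : Measure (Sample N)} [IsFiniteMeasure P]
    [IsFiniteMeasure Q] (hy : MemLp (fun s : Sample N => s.2) 2 Q)
    {F : PureState N → PureState N → ℝ} (hF : Continuous (Function.uncurry F)) :
    ∫ s, ∫ t, t.2 * F s.1 t.1 ∂Q ∂P = ∫ t, t.2 * ∫ s, F s.1 t.1 ∂P ∂Q := by
  obtain ⟨C, hC⟩ := exists_bound_of_continuous hF
  rw [integral_integral_swap]
  · simp_rw [integral_const_mul]
  · have hyi : Integrable (fun p : Sample N × Sample N => p.2.2) (P.prod Q) :=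
      (hy.integrable (by norm_num)).comp_snd P
    have hFc : Continuous fun p : Sample N × Sample N => F p.1.1 p.2.1 :=
      hF.comp (by fun_prop : Continuous fun p : Sample N × Sample N => (p.1.1, p.2.1))
    exact hyi.mul_bdd hFc.aestronglyMeasurable
      (Filter.Eventually.of_forall fun p => hC (p.1.1, p.2.1))

/-! ### Correlation of test labels with a training state -/

/-- The correlation `𝔼 [y (Tr[φ ρ] - 1/d)]` of the label of a test sample `(ρ, y)` with its
overlap with the state `φ`. -/
noncomputable def labelOverlap (Q : Measure (Sample N)) (φ : PureState N) : ℝ :=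
  ∫ s, s.2 * centredKernel φ s.1 ∂Q

lemma continuous_labelOverlap {Q : Measure (Sample N)} [IsFiniteMeasure Q]
    (hy : MemLp (fun s : Sample N => s.2) 2 Q) : Continuous (labelOverlap Q) := by
  unfold labelOverlap
  refine continuous_of_dominated (bound := fun s => |s.2|) (fun φ => ?_) (fun φ => ?_)
    (hy.integrable (by norm_num)).abs ?_
  · exact Continuous.aestronglyMeasurable (by fun_prop)
  · refine Filter.Eventually.of_forall fun s => ?_
    rw [norm_mul, Real.norm_eq_abs, Real.norm_eq_abs]
    exact mul_le_of_le_one_right (abs_nonneg _) (abs_centredKernel_le_one _ _)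
  · exact Filter.Eventually.of_forall fun s => by fun_prop

lemma integral_centredKernel_mul_labelOverlap {P Q : Measure (Sample N)} [IsFiniteMeasure Q]
    (hP : IsDesignSample P) (hy : MemLp (fun s : Sample N => s.2) 2 Q) (ψ : PureState N) :
    ∫ s, centredKernel ψ s.1 * labelOverlap Q s.1 ∂P = designConst N * labelOverlap Q ψ := by
  have := hP.isProbabilityMeasure
  have h : ∀ s : Sample N, centredKernel ψ s.1 * labelOverlap Q s.1
      = ∫ t, t.2 * (centredKernel ψ s.1 * centredKernel t.1 s.1) ∂Q := fun s => by
    rw [labelOverlap, ← integral_const_mul]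
    refine integral_congr_ae (Filter.Eventually.of_forall fun t => ?_)
    simp only
    rw [centredKernel_comm t.1]
    ring
  simp_rw [h]
  rw [integral_integral_label_mul_swap hy
    (F := fun φ χ => centredKernel ψ φ * centredKernel χ φ) (by fun_prop)]
  simp_rw [integral_centredKernel_mul hP]
  rw [labelOverlap, ← integral_const_mul]
  congr 1; ext t; ring

/-- The mean square of `labelOverlap Q` is the same for every 2-design law `P`. -/
lemma integral_labelOverlap_sq_eq {P Q : Measure (Sample N)} [IsFiniteMeasure Q]
    (hP : IsDesignSample P) (hy : MemLp (fun s : Sample N => s.2) 2 Q) :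
    ∫ s, labelOverlap Q s.1 ^ 2 ∂P
      = designConst N * ∫ t, t.2 * labelOverlap Q t.1 ∂Q := by
  have := hP.isProbabilityMeasure
  have hc := continuous_labelOverlap hy
  have h : ∀ s : Sample N, labelOverlap Q s.1 ^ 2
      = ∫ t, t.2 * (centredKernel t.1 s.1 * labelOverlap Q s.1) ∂Q := fun s => by
    rw [sq]
    nth_rewrite 1 [labelOverlap]
    rw [← integral_mul_const]
    refine integral_congr_ae (Filter.Eventually.of_forall fun t => ?_)
    simp only
    rw [centredKernel_comm t.1]
    ring
  simp_rw [h]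
  rw [integral_integral_label_mul_swap hy
    (F := fun φ χ => centredKernel χ φ * labelOverlap Q φ) (by fun_prop)]
  simp_rw [integral_centredKernel_mul_labelOverlap hP hy]
  rw [← integral_const_mul]
  congr 1; ext t; ring

/-- With `T` the mean square in question, Cauchy–Schwarz under `Q` turns
`integral_labelOverlap_sq_eq` into `T ^ 2 ≤ designConst N ^ 2 * 𝔼 y² * T`. -/
lemma integral_labelOverlap_sq_le {P Q : Measure (Sample N)} (hP : IsDesignSample P)
    (hQ : IsDesignSample Q) (hy : MemLp (fun s : Sample N => s.2) 2 Q) :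
    ∫ s, labelOverlap Q s.1 ^ 2 ∂P ≤ designConst N ^ 2 * ∫ s, s.2 ^ 2 ∂Q := by
  have := hQ.isProbabilityMeasure
  have hg := memLp_comp_fst Q (continuous_labelOverlap hy)
  have hcs := sq_integral_mul_le hy hg
  have hQT := integral_labelOverlap_sq_eq hQ hy
  rw [integral_labelOverlap_sq_eq hP hy, ← hQT]
  have h0 : 0 ≤ ∫ s, labelOverlap Q s.1 ^ 2 ∂Q := integral_nonneg fun s => sq_nonneg _
  have hy0 : 0 ≤ ∫ s, s.2 ^ 2 ∂Q := integral_nonneg fun s => sq_nonneg _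
  set T := ∫ s, labelOverlap Q s.1 ^ 2 ∂Q
  have hTT : T * T ≤ designConst N ^ 2 * (∫ s, s.2 ^ 2 ∂Q) * T := by
    calc T * T = designConst N ^ 2 * (∫ t, t.2 * labelOverlap Q t.1 ∂Q) ^ 2 := by
          rw [hQT]; ring
      _ ≤ designConst N ^ 2 * ((∫ s, s.2 ^ 2 ∂Q) * T) := by gcongr
      _ = _ := by ring
  rcases h0.eq_or_lt with h | h
  · rw [← h]; positivity
  · exact le_of_mul_le_mul_right hTT h

/-! ### Predictions -/

lemma prediction_eq (S : Fin n → Sample N) (v : Fin n → ℝ) (ψ : PureState N) :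
    prediction S v ψ = ∑ a, v a * kernel (S a).1 ψ := by
  simp only [prediction, observable, Finset.sum_mul, Matrix.trace_sum, Complex.re_sum,
    smul_mul_assoc, Matrix.trace_smul, smul_eq_mul, Complex.re_ofReal_mul, kernel]

@[fun_prop]
lemma continuous_prediction {X : Type*} [TopologicalSpace X] {S : X → Fin n → Sample N}
    {v : X → Fin n → ℝ} {f : X → PureState N} (hS : Continuous S) (hv : Continuous v)
    (hf : Continuous f) : Continuous fun x => prediction (S x) (v x) (f x) := by
  simp only [prediction_eq]
  fun_prop

/-- The fluctuating part of the prediction. -/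
noncomputable def centredPrediction (S : Fin n → Sample N) (v : Fin n → ℝ) (ψ : PureState N) :
    ℝ :=
  ∑ a, v a * centredKernel (S a).1 ψ

@[fun_prop]
lemma continuous_centredPrediction {X : Type*} [TopologicalSpace X] (S : Fin n → Sample N)
    (v : Fin n → ℝ) {f : X → PureState N} (hf : Continuous f) :
    Continuous fun x => centredPrediction S v (f x) := by
  unfold centredPrediction
  fun_prop

lemma prediction_eq_add (S : Fin n → Sample N) (v : Fin n → ℝ) (ψ : PureState N) :
    prediction S v ψ = (∑ a, v a) / 2 ^ N + centredPrediction S v ψ := by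
  rw [prediction_eq, centredPrediction, Finset.sum_div, ← Finset.sum_add_distrib]
  refine Finset.sum_congr rfl fun a _ => ?_
  rw [centredKernel]; ring

lemma sq_sum_le_card_mul (v : Fin n → ℝ) : (∑ a, v a) ^ 2 ≤ n * ∑ a, v a ^ 2 := by
  simpa using sq_sum_le_card_mul_sum_sq (s := (Finset.univ : Finset (Fin n))) (f := v)

lemma integral_centredPrediction_sq_le {Q : Measure (Sample N)} (hQ : IsDesignSample Q)
    (S : Fin n → Sample N) (v : Fin n → ℝ) :
    ∫ s, centredPrediction S v s.1 ^ 2 ∂Q ≤ n / (2 ^ N) ^ 2 * ∑ a, v a ^ 2 := by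
  have := hQ.isProbabilityMeasure
  have hi : ∀ a b, Integrable (fun s : Sample N => v a * v b *
      (centredKernel (S a).1 s.1 * centredKernel (S b).1 s.1)) Q := fun a b =>
    (integrable_mul_of_memLp_two (memLp_comp_fst Q (f := fun φ => centredKernel (S a).1 φ)
      (by fun_prop)) (memLp_comp_fst Q (f := fun φ => centredKernel (S b).1 φ)
      (by fun_prop))).const_mul _
  have h : ∀ s : Sample N, centredPrediction S v s.1 ^ 2 = ∑ a, ∑ b, v a * v b *
      (centredKernel (S a).1 s.1 * centredKernel (S b).1 s.1) := fun s => by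
    rw [sq, centredPrediction, Finset.sum_mul_sum]
    exact Finset.sum_congr rfl fun a _ => Finset.sum_congr rfl fun b _ => by ring
  simp_rw [h]
  rw [integral_finsetSum _ fun a _ => integrable_finsetSum _ fun b _ => hi a b]
  simp_rw [fun a => integral_finsetSum Finset.univ fun b _ => hi a b, integral_const_mul,
    integral_centredKernel_mul hQ]
  have habs : ∀ a b, v a * v b * (designConst N * centredKernel (S a).1 (S b).1)
      ≤ designConst N * (|v a| * |v b|) := fun a b => by
    have h1 : v a * v b * centredKernel (S a).1 (S b).1 ≤ |v a| * |v b| := by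
      rw [← abs_mul]
      refine (le_abs_self _).trans ?_
      rw [abs_mul]
      exact mul_le_of_le_one_right (abs_nonneg _) (abs_centredKernel_le_one _ _)
    nlinarith [designConst_pos N]
  calc _ ≤ ∑ a, ∑ b, designConst N * (|v a| * |v b|) :=
        Finset.sum_le_sum fun a _ => Finset.sum_le_sum fun b _ => habs a b
    _ = designConst N * (∑ a, |v a|) ^ 2 := by
        rw [sq, Finset.sum_mul_sum, Finset.mul_sum]
        simp_rw [Finset.mul_sum]
    _ ≤ 1 / (2 ^ N) ^ 2 * (n * ∑ a, v a ^ 2) := by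
        have := sq_sum_le_card_mul fun a => |v a|
        simp only [sq_abs] at this
        gcongr
        exact designConst_le N
    _ = _ := by ring

lemma integral_prediction_sq_le {Q : Measure (Sample N)} (hQ : IsDesignSample Q)
    (S : Fin n → Sample N) (v : Fin n → ℝ) :
    ∫ s, prediction S v s.1 ^ 2 ∂Q ≤ 4 * (n / (2 ^ N) ^ 2 * ∑ a, v a ^ 2) := by
  have := hQ.isProbabilityMeasure
  have hi := (memLp_comp_fst Q (f := fun φ => centredPrediction S v φ)
    (by fun_prop)).integrable_sq
  have h : ∀ s : Sample N, prediction S v s.1 ^ 2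
      ≤ 2 * (1 / (2 ^ N) ^ 2 * (∑ a, v a) ^ 2) + 2 * centredPrediction S v s.1 ^ 2 := fun s => by
    rw [prediction_eq_add]
    have := sq_nonneg ((∑ a, v a) / 2 ^ N - centredPrediction S v s.1)
    have e : 1 / (2 ^ N) ^ 2 * (∑ a, v a) ^ 2 = ((∑ a, v a) / 2 ^ N) ^ 2 := by
      rw [div_pow]; ring
    rw [e]
    nlinarith
  have hs : 1 / ((2 : ℝ) ^ N) ^ 2 * (∑ a, v a) ^ 2 ≤ n / (2 ^ N) ^ 2 * ∑ a, v a ^ 2 := by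
    calc _ ≤ 1 / ((2 : ℝ) ^ N) ^ 2 * (n * ∑ a, v a ^ 2) := by
          gcongr; exact sq_sum_le_card_mul v
      _ = _ := by ring
  calc _ ≤ ∫ s, (2 * (1 / (2 ^ N) ^ 2 * (∑ a, v a) ^ 2)
          + 2 * centredPrediction S v s.1 ^ 2) ∂Q := by
        refine integral_mono_of_nonneg (Filter.Eventually.of_forall fun s => sq_nonneg _)
          ((integrable_const _).add (hi.const_mul 2)) (Filter.Eventually.of_forall h)
    _ = 2 * (1 / (2 ^ N) ^ 2 * (∑ a, v a) ^ 2)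
          + 2 * ∫ s, centredPrediction S v s.1 ^ 2 ∂Q := by
        rw [integral_add (integrable_const _) (hi.const_mul 2), integral_const,
          integral_const_mul, probReal_univ, one_smul]
    _ ≤ _ := by linarith [integral_centredPrediction_sq_le hQ S v]

/-! ### Near-identity kernel matrices -/

/-- The squared Frobenius distance of the kernel matrix from the identity. -/
noncomputable def kernelDeviation (S : Fin n → Sample N) : ℝ :=
  ∑ a, ∑ b, (kernelMatrix S - 1) a b ^ 2

lemma kernelDeviation_nonneg (S : Fin n → Sample N) : 0 ≤ kernelDeviation S :=
  Finset.sum_nonneg fun _ _ => Finset.sum_nonneg fun _ _ => sq_nonneg _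

lemma sum_sq_mulVec_le (A : Matrix (Fin n) (Fin n) ℝ) (x : Fin n → ℝ) :
    ∑ a, (A *ᵥ x) a ^ 2 ≤ (∑ a, ∑ b, A a b ^ 2) * ∑ b, x b ^ 2 := by
  rw [Finset.sum_mul]
  exact Finset.sum_le_sum fun a _ => Finset.sum_mul_sq_le_sq_mul_sq Finset.univ (A a) x

lemma sum_add_sq_le (x z : Fin n → ℝ) :
    ∑ a, (x a + z a) ^ 2 ≤ 2 * ∑ a, x a ^ 2 + 2 * ∑ a, z a ^ 2 := by
  rw [Finset.mul_sum, Finset.mul_sum, ← Finset.sum_add_distrib]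
  exact Finset.sum_le_sum fun a _ => by nlinarith [sq_nonneg (x a - z a)]

/-- The inverse of a near-identity kernel matrix has norm at most `2`. -/
lemma sum_sq_le_of_mulVec_eq {S : Fin n → Sample N} (hS : kernelDeviation S < 1 / 4)
    {x r : Fin n → ℝ} (h : kernelMatrix S *ᵥ x = r) :
    ∑ a, x a ^ 2 ≤ 4 * ∑ a, r a ^ 2 := by
  have hx : ∀ a, x a = r a + -((kernelMatrix S - 1) *ᵥ x) a := fun a => by
    rw [← h, Matrix.sub_mulVec, Matrix.one_mulVec, Pi.sub_apply]; ring
  have h1 := sum_add_sq_le r fun a => -((kernelMatrix S - 1) *ᵥ x) a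
  simp_rw [← hx, neg_sq] at h1
  have h2 := sum_sq_mulVec_le (kernelMatrix S - 1) x
  have h3 : 0 ≤ ∑ a, x a ^ 2 := Finset.sum_nonneg fun _ _ => sq_nonneg _
  rw [← kernelDeviation] at h2
  nlinarith

lemma isUnit_det_kernelMatrix {S : Fin n → Sample N} (hS : kernelDeviation S < 1 / 4) :
    IsUnit (kernelMatrix S).det := by
  rw [isUnit_iff_ne_zero]
  intro h
  obtain ⟨x, hx, hx0⟩ := Matrix.exists_mulVec_eq_zero_iff.mpr h
  have h1 := sum_sq_le_of_mulVec_eq hS hx0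
  have h2 : ∑ a, x a ^ 2 = 0 :=
    le_antisymm (by simpa using h1) (Finset.sum_nonneg fun _ _ => sq_nonneg _)
  rw [Finset.sum_eq_zero_iff_of_nonneg fun _ _ => sq_nonneg _] at h2
  exact hx (funext fun a => by simpa using h2 a (Finset.mem_univ a))

lemma prediction_train (S : Fin n → Sample N) (θ : Fin n → ℝ) (i : Fin n) :
    prediction S θ (S i).1 = (kernelMatrix S *ᵥ θ) i := by
  rw [prediction_eq, Matrix.mulVec, dotProduct]
  refine Finset.sum_congr rfl fun a _ => ?_
  rw [kernelMatrix, Matrix.of_apply, kernel_comm, mul_comm]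

lemma trainLoss_eq_zero_iff (hn : 0 < n) (S : Fin n → Sample N) (θ : Fin n → ℝ) :
    trainLoss S θ = 0 ↔ kernelMatrix S *ᵥ θ = fun a => (S a).2 := by
  have hn' : (1 / (2 * (n : ℝ))) ≠ 0 := by positivity
  rw [trainLoss, loss, mul_eq_zero, or_iff_right hn',
    Finset.sum_eq_zero_iff_of_nonneg fun _ _ => sq_nonneg _, funext_iff]
  simp [prediction_train, sub_eq_zero]

lemma trainLoss_inv_mulVec (hn : 0 < n) {S : Fin n → Sample N}
    (h : IsUnit (kernelMatrix S).det) :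
    trainLoss S ((kernelMatrix S)⁻¹ *ᵥ fun a => (S a).2) = 0 := by
  rw [trainLoss_eq_zero_iff hn, Matrix.mulVec_mulVec, Matrix.mul_nonsing_inv _ h,
    Matrix.one_mulVec]

lemma eq_inv_mulVec_of_trainLoss_eq_zero (hn : 0 < n) {S : Fin n → Sample N}
    (h : IsUnit (kernelMatrix S).det) {θ : Fin n → ℝ} (hθ : trainLoss S θ = 0) :
    θ = (kernelMatrix S)⁻¹ *ᵥ fun a => (S a).2 := by
  rw [trainLoss_eq_zero_iff hn] at hθ
  rw [← hθ, Matrix.mulVec_mulVec, Matrix.nonsing_inv_mul _ h, Matrix.one_mulVec]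

/-! ### The change of the expected loss on one test sample -/

lemma abs_le_half_add_of_sq_le_mul {x A B : ℝ} (hA : 0 ≤ A) (hB : 0 ≤ B) (h : x ^ 2 ≤ A * B) :
    |x| ≤ (A + B) / 2 :=
  abs_le_of_sq_le_sq (by nlinarith [sq_nonneg (A - B)]) (by positivity)

lemma memLp_error {Q : Measure (Sample N)} [IsFiniteMeasure Q]
    (hy : MemLp (fun s : Sample N => s.2) 2 Q) (S : Fin n → Sample N) (θ : Fin n → ℝ) :
    MemLp (fun s : Sample N => prediction S θ s.1 - s.2) 2 Q :=
  (memLp_comp_fst Q (f := fun φ => prediction S θ φ) (by fun_prop)).sub hy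

lemma integral_error_sq_le {Q : Measure (Sample N)} (hQ : IsDesignSample Q)
    (hy : MemLp (fun s : Sample N => s.2) 2 Q) (S : Fin n → Sample N) (θ : Fin n → ℝ) :
    ∫ s, (prediction S θ s.1 - s.2) ^ 2 ∂Q
      ≤ 8 * (n / (2 ^ N) ^ 2 * ∑ a, θ a ^ 2) + 2 * ∫ s, s.2 ^ 2 ∂Q := by
  have := hQ.isProbabilityMeasure
  have i1 := (memLp_comp_fst Q (f := fun φ => prediction S θ φ)
    (by fun_prop)).integrable_sq.const_mul 2
  have i2 := hy.integrable_sq.const_mul 2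
  calc _ ≤ ∫ s, (2 * prediction S θ s.1 ^ 2 + 2 * s.2 ^ 2) ∂Q := by
        refine integral_mono (memLp_error hy S θ).integrable_sq (i1.add i2) fun s => ?_
        simp only
        nlinarith [sq_nonneg (prediction S θ s.1 + s.2)]
    _ = 2 * ∫ s, prediction S θ s.1 ^ 2 ∂Q + 2 * ∫ s, s.2 ^ 2 ∂Q := by
        rw [integral_add i1 i2, integral_const_mul, integral_const_mul]
    _ ≤ _ := by linarith [integral_prediction_sq_le hQ S θ]

lemma integral_label_mul_centredPrediction {Q : Measure (Sample N)} [IsFiniteMeasure Q]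
    (hy : MemLp (fun s : Sample N => s.2) 2 Q) (S : Fin n → Sample N) (w : Fin n → ℝ) :
    ∫ s, s.2 * centredPrediction S w s.1 ∂Q = ∑ a, w a * labelOverlap Q (S a).1 := by
  simp_rw [centredPrediction, labelOverlap, Finset.mul_sum]
  rw [integral_finsetSum]
  · refine Finset.sum_congr rfl fun a _ => ?_
    rw [← integral_const_mul]
    congr 1; ext s; ring
  · intro a _
    exact integrable_mul_of_memLp_two hy (memLp_comp_fst Q
      (f := fun φ => w a * centredKernel (S a).1 φ) (by fun_prop))

/-- The residuals of the initial model on the training set. -/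
noncomputable def residual (S : Fin n → Sample N) (θ₀ : Fin n → ℝ) (a : Fin n) : ℝ :=
  prediction S θ₀ (S a).1 - (S a).2

/-- Replacing `θ₀` by an interpolating parameter `θ` changes the prediction by
`- ∑ r / d`, up to terms whose correlation with the test error is of second order. With
`w = θ₀ - y`, `η = (k - 1) θ₀` and `δ = (θ - θ₀) + r`, the change is
`- ∑ r / d - f̃_w - f̃_η + f_δ`, where `f̃` is the centred prediction. Here `η` and `δ` are small
because `k` is close to `1`, and `f̃_w` is nearly uncorrelated with the test labels. -/
lemma integral_error_sq_ge_of_interpolates {Q : Measure (Sample N)} (hQ : IsDesignSample Q)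
    (hy : MemLp (fun s : Sample N => s.2) 2 Q) {S : Fin n → Sample N}
    (hS : kernelDeviation S < 1 / 4) (θ₀ : Fin n → ℝ) {θ : Fin n → ℝ}
    (hθ : kernelMatrix S *ᵥ θ = fun a => (S a).2) :
    (∫ s, (prediction S θ₀ s.1 - s.2) ^ 2 ∂Q) / 2
        - (∑ a, residual S θ₀ a) / 2 ^ N * ∫ s, (prediction S θ₀ s.1 - s.2) ∂Q
        - (48 * (n / (2 ^ N) ^ 2) * (∑ a, θ₀ a ^ 2 + ∑ a, (S a).2 ^ 2)
          + 4 * kernelDeviation S * ∫ s, s.2 ^ 2 ∂Q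
          + (2 ^ N) ^ 2 * ∑ a, labelOverlap Q (S a).1 ^ 2)
      ≤ (∫ s, (prediction S θ s.1 - s.2) ^ 2 ∂Q) / 2 := by
  have := hQ.isProbabilityMeasure
  have hn1 : ∀ a : Fin n, (1 : ℝ) ≤ n := fun a => by exact_mod_cast a.pos
  set r := residual S θ₀ with hr
  set w : Fin n → ℝ := fun a => θ₀ a - (S a).2 with hw
  set η : Fin n → ℝ := (kernelMatrix S - 1) *ᵥ θ₀ with hη
  set δ : Fin n → ℝ := fun a => θ a - θ₀ a + r a with hδ
  set ε := kernelDeviation S with hε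
  have hε0 : 0 ≤ ε := kernelDeviation_nonneg S
  set κ : ℝ := n / (2 ^ N) ^ 2 with hκ
  have hκ0 : 0 ≤ κ := by positivity
  set A := ∑ a, θ₀ a ^ 2 with hA
  set Y := ∑ a, (S a).2 ^ 2 with hY
  have hA0 : 0 ≤ A := Finset.sum_nonneg fun _ _ => sq_nonneg _
  have hY0 : 0 ≤ Y := Finset.sum_nonneg fun _ _ => sq_nonneg _
  -- sizes of the four vectors
  have hW : ∑ a, w a ^ 2 ≤ 2 * A + 2 * Y := by
    have h := sum_add_sq_le θ₀ fun a => -(S a).2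
    simpa only [neg_sq, ← sub_eq_add_neg] using h
  have hE : ∑ a, η a ^ 2 ≤ ε * A := sum_sq_mulVec_le _ _
  have hrw : ∀ a, r a = w a + η a := fun a => by
    rw [hr, residual, prediction_train, hη, Matrix.sub_mulVec, Matrix.one_mulVec, Pi.sub_apply]
    ring
  have hR : ∑ a, r a ^ 2 ≤ 5 * A + 4 * Y := by
    have h := sum_add_sq_le w η
    simp_rw [← hrw] at h
    nlinarith
  have hKv : kernelMatrix S *ᵥ (θ - θ₀) = fun a => -r a := by
    rw [Matrix.mulVec_sub, hθ]
    funext a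
    rw [hr, Pi.sub_apply, residual, prediction_train]; ring
  have hδv : ∀ a, δ a = -((kernelMatrix S - 1) *ᵥ (θ - θ₀)) a := fun a => by
    rw [Matrix.sub_mulVec, Matrix.one_mulVec, hKv, Pi.sub_apply, Pi.sub_apply]
    simp only [hδ]; ring
  have hD : ∑ a, δ a ^ 2 ≤ ε * (4 * (5 * A + 4 * Y)) := by
    simp_rw [hδv, neg_sq]
    refine (sum_sq_mulVec_le _ _).trans ?_
    have h := sum_sq_le_of_mulVec_eq hS hKv
    simp_rw [neg_sq] at h
    exact mul_le_mul_of_nonneg_left (by linarith) hε0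
  -- square-integrability of the functions involved
  have he := memLp_error hy S θ₀
  have hf0 := memLp_comp_fst Q (f := fun φ => prediction S θ₀ φ) (by fun_prop)
  have hfδ := memLp_comp_fst Q (f := fun φ => prediction S δ φ) (by fun_prop)
  have hfw := memLp_comp_fst Q (f := fun φ => centredPrediction S w φ) (by fun_prop)
  have hfη := memLp_comp_fst Q (f := fun φ => centredPrediction S η φ) (by fun_prop)
  have hE2 := integral_error_sq_le hQ hy S θ₀
  have hE20 : 0 ≤ ∫ s, (prediction S θ₀ s.1 - s.2) ^ 2 ∂Q := integral_nonneg fun s => sq_nonneg _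
  have hq0 : 0 ≤ ∫ s, s.2 ^ 2 ∂Q := integral_nonneg fun s => sq_nonneg _
  -- the four remainder terms
  have t1 : |∫ s, prediction S θ₀ s.1 * centredPrediction S w s.1 ∂Q|
      ≤ (4 * (κ * A) + κ * (2 * A + 2 * Y)) / 2 := by
    refine abs_le_half_add_of_sq_le_mul (by positivity) (by positivity)
      ((sq_integral_mul_le hf0 hfw).trans ?_)
    exact mul_le_mul (integral_prediction_sq_le hQ S θ₀)
      ((integral_centredPrediction_sq_le hQ S w).trans (by gcongr))
      (integral_nonneg fun s => sq_nonneg _) (by positivity)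
  have t2 : |∫ s, s.2 * centredPrediction S w s.1 ∂Q|
      ≤ (κ * (2 * A + 2 * Y) + (2 ^ N) ^ 2 * ∑ a, labelOverlap Q (S a).1 ^ 2) / 2 := by
    rw [integral_label_mul_centredPrediction hy]
    have hκ1 : ∑ a, w a ^ 2 / (2 ^ N) ^ 2 ≤ κ * (2 * A + 2 * Y) := by
      refine le_trans ?_ (mul_le_mul_of_nonneg_left hW hκ0)
      rw [Finset.mul_sum]
      refine Finset.sum_le_sum fun a _ => ?_
      rw [hκ, div_mul_eq_mul_div]
      gcongr
      nlinarith [hn1 a, sq_nonneg (w a)]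
    -- the factor `2 ^ N` balances `w`, of order one, against the overlaps, of order `1 / d ^ 2`
    have hcs := Finset.sum_mul_sq_le_sq_mul_sq Finset.univ (fun a => w a / 2 ^ N)
      fun a => 2 ^ N * labelOverlap Q (S a).1
    have hcongr : ∀ a, w a / 2 ^ N * (2 ^ N * labelOverlap Q (S a).1)
        = w a * labelOverlap Q (S a).1 := fun a => by field_simp
    simp only [hcongr, div_pow, mul_pow, ← Finset.mul_sum] at hcs
    refine abs_le_half_add_of_sq_le_mul (by positivity) ?_ (hcs.trans ?_)
    · exact mul_nonneg (by positivity) (Finset.sum_nonneg fun _ _ => sq_nonneg _)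
    · exact mul_le_mul_of_nonneg_right hκ1
        (mul_nonneg (by positivity) (Finset.sum_nonneg fun _ _ => sq_nonneg _))
  have t3 : |∫ s, (prediction S θ₀ s.1 - s.2) * centredPrediction S η s.1 ∂Q|
      ≤ (ε * (∫ s, (prediction S θ₀ s.1 - s.2) ^ 2 ∂Q) + κ * A) / 2 := by
    refine abs_le_half_add_of_sq_le_mul (by positivity) (by positivity)
      ((sq_integral_mul_le he hfη).trans ?_)
    calc _ ≤ (∫ s, (prediction S θ₀ s.1 - s.2) ^ 2 ∂Q) * (κ * (ε * A)) := by
          gcongr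
          exact (integral_centredPrediction_sq_le hQ S η).trans (by gcongr)
      _ = _ := by ring
  have t4 : |∫ s, (prediction S θ₀ s.1 - s.2) * prediction S δ s.1 ∂Q|
      ≤ (ε * (∫ s, (prediction S θ₀ s.1 - s.2) ^ 2 ∂Q) + 16 * κ * (5 * A + 4 * Y)) / 2 := by
    refine abs_le_half_add_of_sq_le_mul (by positivity) (by positivity)
      ((sq_integral_mul_le he hfδ).trans ?_)
    calc _ ≤ (∫ s, (prediction S θ₀ s.1 - s.2) ^ 2 ∂Q)
            * (4 * (κ * (ε * (4 * (5 * A + 4 * Y))))) := by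
          gcongr
          exact (integral_prediction_sq_le hQ S δ).trans (by gcongr)
      _ = _ := by ring
  -- the change of the prediction, and its correlation with the error
  have hlin : ∀ s : Sample N, prediction S θ s.1 = prediction S θ₀ s.1
      - (∑ a, r a) / 2 ^ N - centredPrediction S w s.1 - centredPrediction S η s.1
      + prediction S δ s.1 := fun s => by
    have h1 : prediction S δ s.1
        = prediction S θ s.1 - prediction S θ₀ s.1 + prediction S r s.1 := by
      simp only [prediction_eq, ← Finset.sum_sub_distrib, ← Finset.sum_add_distrib, hδ]
      exact Finset.sum_congr rfl fun a _ => by ring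
    have h2 : centredPrediction S r s.1
        = centredPrediction S w s.1 + centredPrediction S η s.1 := by
      simp only [centredPrediction, ← Finset.sum_add_distrib, hrw, add_mul]
    rw [h1, prediction_eq_add S r, h2]; ring
  have hpt : ∀ s : Sample N, (prediction S θ₀ s.1 - s.2) ^ 2
      - 2 * ((∑ a, r a) / 2 ^ N) * (prediction S θ₀ s.1 - s.2)
      - 2 * (prediction S θ₀ s.1 * centredPrediction S w s.1)
      + 2 * (s.2 * centredPrediction S w s.1)
      - 2 * ((prediction S θ₀ s.1 - s.2) * centredPrediction S η s.1)
      + 2 * ((prediction S θ₀ s.1 - s.2) * prediction S δ s.1)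
        ≤ (prediction S θ s.1 - s.2) ^ 2 := fun s => by
    -- the difference of the two sides is the square of the change of the prediction
    have h := sq_nonneg (prediction S θ s.1 - prediction S θ₀ s.1)
    rw [hlin s] at h ⊢
    linarith
  have i0 := he.integrable_sq
  have i1 := (he.integrable (by norm_num)).const_mul (2 * ((∑ a, r a) / 2 ^ N))
  have i2 := (integrable_mul_of_memLp_two hf0 hfw).const_mul 2
  have i3 := (integrable_mul_of_memLp_two hy hfw).const_mul 2
  have i4 := (integrable_mul_of_memLp_two he hfη).const_mul 2
  have i5 := (integrable_mul_of_memLp_two he hfδ).const_mul 2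
  have hint := integral_mono (((((i0.sub i1).sub i2).add i3).sub i4).add i5)
    (memLp_error hy S θ).integrable_sq hpt
  rw [integral_add' ((((i0.sub i1).sub i2).add i3).sub i4) i5,
    integral_sub' (((i0.sub i1).sub i2).add i3) i4, integral_add' ((i0.sub i1).sub i2) i3,
    integral_sub' (i0.sub i1) i2, integral_sub' i0 i1, integral_const_mul, integral_const_mul,
    integral_const_mul, integral_const_mul, integral_const_mul] at hint
  have hεE : ε * (∫ s, (prediction S θ₀ s.1 - s.2) ^ 2 ∂Q)
      ≤ 2 * (κ * A) + 2 * (ε * ∫ s, s.2 ^ 2 ∂Q) := by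
    have h1 := mul_le_mul_of_nonneg_left hE2 hε0
    have h2 := mul_le_mul_of_nonneg_right hS.le (mul_nonneg hκ0 hA0)
    linarith
  have hκA : 0 ≤ κ * A := mul_nonneg hκ0 hA0
  have hκY : 0 ≤ κ * Y := mul_nonneg hκ0 hY0
  have hεq : 0 ≤ ε * ∫ s, s.2 ^ 2 ∂Q := mul_nonneg hε0 hq0
  have hg0 : 0 ≤ ((2 : ℝ) ^ N) ^ 2 * ∑ a, labelOverlap Q (S a).1 ^ 2 :=
    mul_nonneg (by positivity) (Finset.sum_nonneg fun _ _ => sq_nonneg _)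
  linarith [(abs_le.1 t1).2, (abs_le.1 t2).1, (abs_le.1 t3).2, (abs_le.1 t4).1]

/-! ### Expectations over the test set -/

lemma memLp_comp_eval {ι : Type*} [Fintype ι] {X : ι → Type*} [∀ i, MeasurableSpace (X i)]
    {μ : ∀ i, Measure (X i)} [∀ i, IsProbabilityMeasure (μ i)] {i : ι} {f : X i → ℝ}
    (hf : MemLp f 2 (μ i)) : MemLp (fun x : ∀ i, X i => f (x i)) 2 (Measure.pi μ) :=
  hf.comp_measurePreserving (measurePreserving_eval μ i)

section

variable {Q : Fin m → Measure (Sample N)} [∀ b, IsProbabilityMeasure (Q b)]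

lemma memLp_error_pi {b : Fin m} (hy : MemLp (fun s : Sample N => s.2) 2 (Q b))
    (S : Fin n → Sample N) (θ : Fin n → ℝ) :
    MemLp (fun T : Fin m → Sample N => prediction S θ (T b).1 - (T b).2) 2 (Measure.pi Q) :=
  memLp_comp_eval (μ := Q) (f := fun s => prediction S θ s.1 - s.2) (memLp_error hy S θ)

lemma integrable_loss (hy : ∀ b, MemLp (fun s : Sample N => s.2) 2 (Q b))
    (S : Fin n → Sample N) (θ : Fin n → ℝ) :
    Integrable (fun T => loss S θ T) (Measure.pi Q) := by
  unfold loss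
  exact (integrable_finsetSum _ fun b _ =>
    (memLp_error_pi (hy b) S θ).integrable_sq).const_mul _

lemma integral_loss (hy : ∀ b, MemLp (fun s : Sample N => s.2) 2 (Q b))
    (S : Fin n → Sample N) (θ : Fin n → ℝ) :
    ∫ T, loss S θ T ∂(Measure.pi Q)
      = (∑ b, (∫ s, (prediction S θ s.1 - s.2) ^ 2 ∂(Q b)) / 2) / m := by
  unfold loss
  rw [integral_const_mul, integral_finsetSum _ fun b _ =>
    (memLp_error_pi (hy b) S θ).integrable_sq]
  simp_rw [fun b => integral_comp_eval (μ := Q) (i := b)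
    (f := fun s : Sample N => (prediction S θ s.1 - s.2) ^ 2)
    (memLp_error (hy b) S θ).integrable_sq.aestronglyMeasurable]
  rw [← Finset.sum_div]
  ring

lemma loss_nonneg (S : Fin n → Sample N) (θ : Fin n → ℝ) (T : Fin m → Sample N) :
    0 ≤ loss S θ T :=
  mul_nonneg (by positivity) (Finset.sum_nonneg fun _ _ => sq_nonneg _)

@[fun_prop]
lemma continuous_loss {X : Type*} [TopologicalSpace X] {S : X → Fin n → Sample N}
    {θ : X → Fin n → ℝ} {T : X → Fin m → Sample N} (hS : Continuous S) (hθ : Continuous θ)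
    (hT : Continuous T) : Continuous fun x => loss (S x) (θ x) (T x) := by
  unfold loss
  fun_prop

lemma sqrt_mul_le_add {x z : ℝ} (hx : 0 ≤ x) (hz : 0 ≤ z) : √(x * z) ≤ x + z :=
  Real.sqrt_le_iff.2 ⟨by positivity, by nlinarith [mul_nonneg hx hz, sq_nonneg x, sq_nonneg z]⟩

lemma integrable_sqrt_loss (hy : ∀ b, MemLp (fun s : Sample N => s.2) 2 (Q b))
    (S : Fin n → Sample N) (θ : Fin n → ℝ) :
    Integrable (fun T => √(trainLoss S θ * loss S θ T)) (Measure.pi Q) := by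
  refine ((integrable_const (trainLoss S θ)).add (integrable_loss hy S θ)).mono'
    (Continuous.aestronglyMeasurable (by fun_prop)) (Filter.Eventually.of_forall fun T => ?_)
  rw [Real.norm_of_nonneg (Real.sqrt_nonneg _)]
  exact sqrt_mul_le_add (loss_nonneg _ _ _) (loss_nonneg _ _ _)

/-- Cauchy–Schwarz over the training set and over the test set: the mean residual times the mean
test error is at most twice the geometric mean of the two losses. -/
lemma sum_residual_mul_le_sqrt (hn : 0 < n) (hm : 0 < m) (S : Fin n → Sample N)
    (θ : Fin n → ℝ) (T : Fin m → Sample N) :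
    (∑ a, residual S θ a) / (2 * n) * ((∑ b, (prediction S θ (T b).1 - (T b).2)) / m)
      ≤ √(trainLoss S θ * loss S θ T) := by
  have hn' : (0 : ℝ) < n := by exact_mod_cast hn
  have hm' : (0 : ℝ) < m := by exact_mod_cast hm
  refine Real.le_sqrt_of_sq_le ?_
  have h1 := sq_sum_le_card_mul (residual S θ)
  have h2 := sq_sum_le_card_mul fun b => prediction S θ (T b).1 - (T b).2
  have e1 : trainLoss S θ = (1 / (2 * n)) * ∑ a, residual S θ a ^ 2 := rfl
  rw [e1, loss]
  calc _ = (1 / (2 * n * m)) ^ 2 * ((∑ a, residual S θ a) ^ 2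
          * (∑ b, (prediction S θ (T b).1 - (T b).2)) ^ 2) := by field_simp
    _ ≤ (1 / (2 * n * m)) ^ 2 * ((n * ∑ a, residual S θ a ^ 2)
          * (m * ∑ b, (prediction S θ (T b).1 - (T b).2) ^ 2)) := by gcongr
    _ = _ := by field_simp

lemma sum_residual_mul_le_integral_sqrt (hn : 0 < n) (hm : 0 < m)
    (hy : ∀ b, MemLp (fun s : Sample N => s.2) 2 (Q b)) (S : Fin n → Sample N)
    (θ : Fin n → ℝ) :
    (∑ a, residual S θ a) / (2 * n) * ((∑ b, ∫ s, (prediction S θ s.1 - s.2) ∂(Q b)) / m)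
      ≤ ∫ T, √(trainLoss S θ * loss S θ T) ∂(Measure.pi Q) := by
  have hi : ∀ b, Integrable (fun T : Fin m → Sample N => prediction S θ (T b).1 - (T b).2)
      (Measure.pi Q) := fun b =>
    (memLp_error_pi (hy b) S θ).integrable (by norm_num)
  have h := integral_mono
    (((integrable_finsetSum Finset.univ fun b _ => hi b).div_const (m : ℝ)).const_mul
      ((∑ a, residual S θ a) / (2 * n)))
    (integrable_sqrt_loss hy S θ) (sum_residual_mul_le_sqrt hn hm S θ)
  rw [integral_const_mul, integral_div, integral_finsetSum _ fun b _ => hi b] at h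
  simp_rw [fun b => integral_comp_eval (μ := Q) (i := b)
    (f := fun s : Sample N => prediction S θ s.1 - s.2)
    (memLp_error (hy b) S θ).aestronglyMeasurable] at h
  exact h

end

/-- The average second moment of the test labels. -/
noncomputable def testLabelSq (Q : Fin m → Measure (Sample N)) : ℝ :=
  (∑ b, ∫ s, s.2 ^ 2 ∂(Q b)) / m

lemma testLabelSq_nonneg (Q : Fin m → Measure (Sample N)) : 0 ≤ testLabelSq Q :=
  div_nonneg (Finset.sum_nonneg fun _ _ => integral_nonneg fun _ => sq_nonneg _)
    (Nat.cast_nonneg _)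

/-- The amount, depending on the training set, by which the expected test loss may fall short
of the leading-order bound. -/
noncomputable def remainder (θ₀ : Fin n → ℝ) (Q : Fin m → Measure (Sample N))
    (S : Fin n → Sample N) : ℝ :=
  48 * (n / (2 ^ N) ^ 2) * (∑ a, θ₀ a ^ 2 + ∑ a, (S a).2 ^ 2)
    + 4 * kernelDeviation S * testLabelSq Q
    + (2 ^ N) ^ 2 * ((∑ b, ∑ a, labelOverlap (Q b) (S a).1 ^ 2) / m)

lemma remainder_nonneg (θ₀ : Fin n → ℝ) (Q : Fin m → Measure (Sample N))
    (S : Fin n → Sample N) : 0 ≤ remainder θ₀ Q S := by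
  have := kernelDeviation_nonneg S
  have := testLabelSq_nonneg Q
  unfold remainder
  positivity

/-- When the kernel matrix is far from the identity, the remainder exceeds the initial expected
test loss. -/
lemma integral_loss_le_remainder {Q : Fin m → Measure (Sample N)} (hm : 0 < m)
    (hQ : ∀ b, IsDesignSample (Q b)) (hy : ∀ b, MemLp (fun s : Sample N => s.2) 2 (Q b))
    (θ₀ : Fin n → ℝ) {S : Fin n → Sample N} (hS : 1 / 4 ≤ kernelDeviation S) :
    ∫ T, loss S θ₀ T ∂(Measure.pi Q) ≤ remainder θ₀ Q S := by
  have := fun b => (hQ b).isProbabilityMeasure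
  have hm' : (0 : ℝ) < m := by exact_mod_cast hm
  have h1 : ∫ T, loss S θ₀ T ∂(Measure.pi Q)
      ≤ 4 * (n / (2 ^ N) ^ 2 * ∑ a, θ₀ a ^ 2) + testLabelSq Q := by
    rw [integral_loss hy S θ₀, testLabelSq, div_le_iff₀ hm', add_mul, div_mul_cancel₀ _ hm'.ne']
    have h := Finset.sum_le_sum fun b (_ : b ∈ Finset.univ) =>
      div_le_div_of_nonneg_right (integral_error_sq_le (hQ b) (hy b) S θ₀) zero_le_two
    refine h.trans (le_of_eq ?_)
    simp only [add_div, Finset.sum_add_distrib, Finset.sum_const, Finset.card_univ,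
      Fintype.card_fin, nsmul_eq_mul, mul_div_cancel_left₀ _ (two_ne_zero (α := ℝ))]
    ring
  have h4 : testLabelSq Q ≤ 4 * kernelDeviation S * testLabelSq Q :=
    le_mul_of_one_le_left (testLabelSq_nonneg Q) (by linarith)
  have h5 : 4 * (n / ((2 : ℝ) ^ N) ^ 2 * ∑ a, θ₀ a ^ 2)
      ≤ 48 * (n / (2 ^ N) ^ 2) * (∑ a, θ₀ a ^ 2 + ∑ a, (S a).2 ^ 2) := by
    rw [← mul_assoc]
    gcongr
    · norm_num
    · exact le_add_of_nonneg_right (Finset.sum_nonneg fun _ _ => sq_nonneg _)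
  have h6 : 0 ≤ ((2 : ℝ) ^ N) ^ 2
      * ((∑ b, ∑ a, labelOverlap (Q b) (S a).1 ^ 2) / m) := by positivity
  rw [remainder]
  linarith

/-- The bound for a fixed training set whose kernel matrix is close to the identity. -/
lemma integral_loss_ge {Q : Fin m → Measure (Sample N)} (hn : 0 < n) (hm : 0 < m) (hN : 0 < N)
    (hQ : ∀ b, IsDesignSample (Q b)) (hy : ∀ b, MemLp (fun s : Sample N => s.2) 2 (Q b))
    (θ₀ : Fin n → ℝ) {θ : Fin n → ℝ} {S : Fin n → Sample N} (hS : kernelDeviation S < 1 / 4)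
    (hθ : kernelMatrix S *ᵥ θ = fun a => (S a).2) :
    (∫ T, loss S θ₀ T ∂(Measure.pi Q))
        - (n : ℝ) / 2 ^ (N - 1) * (∫ T, √(trainLoss S θ₀ * loss S θ₀ T) ∂(Measure.pi Q))
        - remainder θ₀ Q S
      ≤ ∫ T, loss S θ T ∂(Measure.pi Q) := by
  have := fun b => (hQ b).isProbabilityMeasure
  have hn' : (0 : ℝ) < n := by exact_mod_cast hn
  have hm' : (0 : ℝ) < m := by exact_mod_cast hm
  have hd : (2 : ℝ) ^ N = 2 * 2 ^ (N - 1) := by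
    rw [← pow_succ', Nat.sub_add_cancel hN]
  have hb := fun b => integral_error_sq_ge_of_interpolates (hQ b) (hy b) hS θ₀ hθ
  have hsum := div_le_div_of_nonneg_right
    (Finset.sum_le_sum fun b (_ : b ∈ Finset.univ) => hb b) hm'.le
  rw [← integral_loss hy S θ] at hsum
  refine le_trans (le_of_sub_nonneg ?_) hsum
  have hsq := mul_le_mul_of_nonneg_left (sum_residual_mul_le_integral_sqrt hn hm hy S θ₀)
    (by positivity : 0 ≤ (n : ℝ) / 2 ^ (N - 1))
  have e1 : (n : ℝ) / 2 ^ (N - 1) * ((∑ a, residual S θ₀ a) / (2 * n)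
      * ((∑ b, ∫ s, (prediction S θ₀ s.1 - s.2) ∂(Q b)) / m))
      = (∑ a, residual S θ₀ a) / 2 ^ N
        * ((∑ b, ∫ s, (prediction S θ₀ s.1 - s.2) ∂(Q b)) / m) := by
    rw [hd]; field_simp
  rw [e1] at hsq
  rw [integral_loss hy S θ₀, remainder, testLabelSq]
  simp only [Finset.sum_sub_distrib, Finset.sum_add_distrib, ← Finset.mul_sum,
    Finset.sum_const, Finset.card_univ, Fintype.card_fin, nsmul_eq_mul, sub_div, add_div]
  have e2 : ∀ x z : ℝ, ((m : ℝ) * x + m * z) / m = x + z := fun x z => by field_simp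
  simp only [e2, mul_div_assoc] at hsq ⊢
  linarith

/-! ### Expectations over the training set -/

section

variable {P : Fin n → Measure (Sample N)}

lemma kernelDeviation_eq (S : Fin n → Sample N) : kernelDeviation S
    = ∑ a, ∑ b, if a = b then 0 else kernel (S a).1 (S b).1 ^ 2 := by
  refine Finset.sum_congr rfl fun a _ => Finset.sum_congr rfl fun b _ => ?_
  rw [Matrix.sub_apply, Matrix.one_apply, kernelMatrix, Matrix.of_apply]
  split_ifs with h
  · rw [h, kernel_self]; norm_num
  · rw [sub_zero]

lemma continuous_kernelDeviation :
    Continuous (kernelDeviation : (Fin n → Sample N) → ℝ) := by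
  simp_rw [funext kernelDeviation_eq]
  refine continuous_finsetSum _ fun a _ => continuous_finsetSum _ fun b _ => ?_
  split_ifs <;> fun_prop

lemma integral_kernel_sq_pi (hP : ∀ a, IsDesignSample (P a)) {a b : Fin n} (hab : a ≠ b) :
    ∫ S : Fin n → Sample N, kernel (S a).1 (S b).1 ^ 2 ∂(Measure.pi P)
      = 2 * designConst N := by
  have := fun a => (hP a).isProbabilityMeasure
  have hind := (ProbabilityTheory.iIndepFun_pi (μ := P) (X := fun _ s => s)
    fun _ => aemeasurable_id).indepFun hab
  rw [ProbabilityTheory.indepFun_iff_map_prod_eq_prod_map_map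
    (measurable_pi_apply a).aemeasurable (measurable_pi_apply b).aemeasurable] at hind
  have ha : Measure.map (fun S : Fin n → Sample N => S a) (Measure.pi P) = P a :=
    (measurePreserving_eval P a).map_eq
  have hb : Measure.map (fun S : Fin n → Sample N => S b) (Measure.pi P) = P b :=
    (measurePreserving_eval P b).map_eq
  rw [ha, hb] at hind
  have hc : Continuous fun p : Sample N × Sample N => kernel p.1.1 p.2.1 ^ 2 := by fun_prop
  have h := integral_map (μ := Measure.pi P)
    (φ := fun S : Fin n → Sample N => (S a, S b)) (by fun_prop)
    (f := fun p => kernel p.1.1 p.2.1 ^ 2) hc.aestronglyMeasurable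
  rw [← h, hind, integral_prod]
  · simp_rw [integral_kernel_sq (hP b)]
    simp
  · refine Integrable.of_bound (C := 1) hc.aestronglyMeasurable
      (Filter.Eventually.of_forall fun p => ?_)
    rw [Real.norm_of_nonneg (sq_nonneg _)]
    exact pow_le_one₀ (kernel_nonneg _ _) (kernel_le_one _ _)

lemma integrable_kernelDeviation_term [∀ a, IsProbabilityMeasure (P a)] (a b : Fin n) :
    Integrable (fun S : Fin n → Sample N =>
      if a = b then (0 : ℝ) else kernel (S a).1 (S b).1 ^ 2) (Measure.pi P) := by
  split_ifs
  · exact integrable_zero _ _ _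
  · refine Integrable.of_bound (C := 1) (Continuous.aestronglyMeasurable (by fun_prop))
      (Filter.Eventually.of_forall fun p => ?_)
    rw [Real.norm_of_nonneg (sq_nonneg _)]
    exact pow_le_one₀ (kernel_nonneg _ _) (kernel_le_one _ _)

lemma integrable_kernelDeviation [∀ a, IsProbabilityMeasure (P a)] :
    Integrable (fun S => kernelDeviation S) (Measure.pi P) := by
  simp_rw [kernelDeviation_eq]
  exact integrable_finsetSum _ fun a _ => integrable_finsetSum _ fun b _ =>
    integrable_kernelDeviation_term a b

lemma integral_kernelDeviation_le (hP : ∀ a, IsDesignSample (P a)) :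
    ∫ S, kernelDeviation S ∂(Measure.pi P) ≤ 2 * ((n : ℝ) / 2 ^ N) ^ 2 := by
  have := fun a => (hP a).isProbabilityMeasure
  have hc := designConst_pos N
  simp_rw [kernelDeviation_eq]
  rw [integral_finsetSum _ fun a _ => integrable_finsetSum _ fun b _ =>
    integrable_kernelDeviation_term a b]
  simp_rw [fun a => integral_finsetSum Finset.univ fun b _ =>
    integrable_kernelDeviation_term (P := P) a b]
  calc _ ≤ ∑ a : Fin n, ∑ b : Fin n, 2 * designConst N := by
        refine Finset.sum_le_sum fun a _ => Finset.sum_le_sum fun b _ => ?_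
        split_ifs with h
        · simp only [integral_zero]; positivity
        · exact (integral_kernel_sq_pi hP h).le
    _ = n * n * (2 * designConst N) := by simp [mul_assoc]
    _ ≤ n * n * (2 * (1 / (2 ^ N) ^ 2)) := by gcongr; exact designConst_le N
    _ = _ := by ring

lemma integrable_trainLabels [∀ a, IsProbabilityMeasure (P a)]
    (hy : ∀ a, MemLp (fun s : Sample N => s.2) 2 (P a)) :
    Integrable (fun S : Fin n → Sample N => ∑ a, (S a).2 ^ 2) (Measure.pi P) :=
  integrable_finsetSum _ fun a _ => (memLp_comp_eval (μ := P) (f := fun s => s.2) (hy a)).integrable_sq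

lemma integral_trainLabels [∀ a, IsProbabilityMeasure (P a)]
    (hy : ∀ a, MemLp (fun s : Sample N => s.2) 2 (P a)) :
    ∫ S : Fin n → Sample N, ∑ a, (S a).2 ^ 2 ∂(Measure.pi P)
      = ∑ a, ∫ s, s.2 ^ 2 ∂(P a) := by
  rw [integral_finsetSum _ fun a _ => (memLp_comp_eval (μ := P) (f := fun s => s.2) (hy a)).integrable_sq]
  exact Finset.sum_congr rfl fun a _ => integral_comp_eval (μ := P) (i := a)
    (f := fun s : Sample N => s.2 ^ 2) (hy a).integrable_sq.aestronglyMeasurable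

variable {Q : Fin m → Measure (Sample N)}

lemma integrable_labelOverlap_sq_pi [∀ a, IsProbabilityMeasure (P a)] {ν : Measure (Sample N)}
    [IsFiniteMeasure ν] (hν : MemLp (fun s : Sample N => s.2) 2 ν) (a : Fin n) :
    Integrable (fun S : Fin n → Sample N => labelOverlap ν (S a).1 ^ 2) (Measure.pi P) :=
  (memLp_comp_eval (μ := P) (f := fun s => labelOverlap ν s.1)
    (memLp_comp_fst (P a) (continuous_labelOverlap hν))).integrable_sq

lemma integral_labelOverlap_sq_pi_le (hP : ∀ a, IsDesignSample (P a)) {ν : Measure (Sample N)}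
    (hν : IsDesignSample ν) (hy : MemLp (fun s : Sample N => s.2) 2 ν) (a : Fin n) :
    ∫ S : Fin n → Sample N, labelOverlap ν (S a).1 ^ 2 ∂(Measure.pi P)
      ≤ designConst N ^ 2 * ∫ s, s.2 ^ 2 ∂ν := by
  have := fun a => (hP a).isProbabilityMeasure
  have := hν.isProbabilityMeasure
  rw [integral_comp_eval (μ := P) (i := a) (f := fun s : Sample N => labelOverlap ν s.1 ^ 2)
    (memLp_comp_fst (P a) (continuous_labelOverlap hy)).integrable_sq.aestronglyMeasurable]
  exact integral_labelOverlap_sq_le (hP a) hν hy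

lemma integrable_remainder [∀ a, IsProbabilityMeasure (P a)] [∀ b, IsProbabilityMeasure (Q b)]
    (hyP : ∀ a, MemLp (fun s : Sample N => s.2) 2 (P a))
    (hyQ : ∀ b, MemLp (fun s : Sample N => s.2) 2 (Q b)) (θ₀ : Fin n → ℝ) :
    Integrable (remainder θ₀ Q) (Measure.pi P) := by
  unfold remainder
  exact ((((integrable_const _).add (integrable_trainLabels hyP)).const_mul _).add
    ((integrable_kernelDeviation.const_mul _).mul_const _)).add
    (((integrable_finsetSum _ fun b _ => integrable_finsetSum _ fun a _ =>
      integrable_labelOverlap_sq_pi (hyQ b) a).div_const _).const_mul _)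

lemma integral_remainder_le (hn : 0 < n) (hP : ∀ a, IsDesignSample (P a))
    (hQ : ∀ b, IsDesignSample (Q b))
    (hyP : ∀ a, MemLp (fun s : Sample N => s.2) 2 (P a))
    (hyQ : ∀ b, MemLp (fun s : Sample N => s.2) 2 (Q b)) (θ₀ : Fin n → ℝ) :
    ∫ S, remainder θ₀ Q S ∂(Measure.pi P)
      ≤ 64 * ((n : ℝ) / 2 ^ N) ^ 2 * meanSquareScale θ₀ P Q := by
  have := fun a => (hP a).isProbabilityMeasure
  have := fun b => (hQ b).isProbabilityMeasure
  have hn' : (1 : ℝ) ≤ n := by exact_mod_cast hn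
  have hn0 : (n : ℝ) ≠ 0 := by positivity
  have hc := designConst_pos N
  have i1 : Integrable (fun S : Fin n → Sample N =>
      48 * (n / ((2 : ℝ) ^ N) ^ 2) * (∑ a, θ₀ a ^ 2 + ∑ a, (S a).2 ^ 2)) (Measure.pi P) :=
    ((integrable_const _).add (integrable_trainLabels hyP)).const_mul _
  have i2 : Integrable (fun S : Fin n → Sample N => 4 * kernelDeviation S * testLabelSq Q)
      (Measure.pi P) := (integrable_kernelDeviation.const_mul _).mul_const _
  have i3' : ∀ b, Integrable (fun S : Fin n → Sample N => ∑ a, labelOverlap (Q b) (S a).1 ^ 2)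
      (Measure.pi P) := fun b =>
    integrable_finsetSum _ fun a _ => integrable_labelOverlap_sq_pi (hyQ b) a
  have i3 : Integrable (fun S : Fin n → Sample N =>
      ((2 : ℝ) ^ N) ^ 2 * ((∑ b, ∑ a, labelOverlap (Q b) (S a).1 ^ 2) / m)) (Measure.pi P) :=
    ((integrable_finsetSum _ fun b _ => i3' b).div_const _).const_mul _
  have i12 : Integrable (fun S : Fin n → Sample N =>
      48 * (n / ((2 : ℝ) ^ N) ^ 2) * (∑ a, θ₀ a ^ 2 + ∑ a, (S a).2 ^ 2)
        + 4 * kernelDeviation S * testLabelSq Q) (Measure.pi P) := i1.add i2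
  unfold remainder
  rw [integral_add i12 i3, integral_add i1 i2, integral_const_mul,
    integral_add (integrable_const _) (integrable_trainLabels hyP), integral_const,
    probReal_univ, one_smul, integral_trainLabels hyP, integral_mul_const, integral_const_mul,
    integral_const_mul, integral_div, integral_finsetSum _ fun b _ => i3' b]
  have hq0 := testLabelSq_nonneg Q
  have h3 : ((2 : ℝ) ^ N) ^ 2 * ((∑ b, ∫ S : Fin n → Sample N,
      ∑ a, labelOverlap (Q b) (S a).1 ^ 2 ∂(Measure.pi P)) / m)
      ≤ ((n : ℝ) / 2 ^ N) ^ 2 * testLabelSq Q := by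
    have hb : ∀ b, ∫ S : Fin n → Sample N, ∑ a, labelOverlap (Q b) (S a).1 ^ 2 ∂(Measure.pi P)
        ≤ n * (1 / (2 ^ N) ^ 2) ^ 2 * ∫ s, s.2 ^ 2 ∂(Q b) := fun b => by
      have hy0 : 0 ≤ ∫ s, s.2 ^ 2 ∂(Q b) := integral_nonneg fun s => sq_nonneg _
      rw [integral_finsetSum _ fun a _ => integrable_labelOverlap_sq_pi (hyQ b) a]
      calc _ ≤ ∑ a : Fin n, designConst N ^ 2 * ∫ s, s.2 ^ 2 ∂(Q b) :=
            Finset.sum_le_sum fun a _ => integral_labelOverlap_sq_pi_le hP (hQ b) (hyQ b) a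
        _ = n * designConst N ^ 2 * ∫ s, s.2 ^ 2 ∂(Q b) := by simp [mul_assoc]
        _ ≤ _ := by gcongr; exact designConst_le N
    calc _ ≤ ((2 : ℝ) ^ N) ^ 2
          * ((∑ b, n * (1 / (2 ^ N) ^ 2) ^ 2 * ∫ s, s.2 ^ 2 ∂(Q b)) / m) := by
          gcongr with b _
          exact hb b
      _ = n / (2 ^ N) ^ 2 * testLabelSq Q := by
          rw [← Finset.mul_sum, testLabelSq]
          field_simp
      _ ≤ _ := by
          rw [div_pow]
          gcongr
          nlinarith
  have h2 := mul_le_mul_of_nonneg_right (integral_kernelDeviation_le hP) hq0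
  have h1 : 48 * (n / ((2 : ℝ) ^ N) ^ 2) * (∑ a, θ₀ a ^ 2 + ∑ a, ∫ s, s.2 ^ 2 ∂(P a))
      = 48 * ((n : ℝ) / 2 ^ N) ^ 2
        * ((∑ a, θ₀ a ^ 2) / n + (∑ a, ∫ s, s.2 ^ 2 ∂(P a)) / n) := by
    field_simp
  have h4 : 0 ≤ (∑ a, θ₀ a ^ 2) / n + (∑ a, ∫ s, s.2 ^ 2 ∂(P a)) / n := by
    have : 0 ≤ ∑ a, ∫ s, s.2 ^ 2 ∂(P a) :=
      Finset.sum_nonneg fun _ _ => integral_nonneg fun _ => sq_nonneg _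
    positivity
  have e : meanSquareScale θ₀ P Q = ((∑ a, θ₀ a ^ 2) / n
      + (∑ a, ∫ s, s.2 ^ 2 ∂(P a)) / n) + testLabelSq Q := rfl
  rw [h1, e]
  have hx : 0 ≤ ((n : ℝ) / 2 ^ N) ^ 2 := by positivity
  nlinarith [mul_nonneg hx h4, mul_nonneg hx hq0]

end

/-! ### Probability estimates -/

/-- Markov's inequality in a form that includes the threshold `t = 0`. -/
lemma measure_lt_le_of_integral_le {Ω : Type*} [MeasurableSpace Ω] {μ : Measure Ω}
    [IsFiniteMeasure μ] {f : Ω → ℝ} (hf : Integrable f μ) (hf0 : ∀ x, 0 ≤ f x) {t p : ℝ}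
    (ht : 0 ≤ t) (h : ∫ x, f x ∂μ ≤ p * t) : μ {x | t < f x} ≤ ENNReal.ofReal p := by
  rcases ht.eq_or_lt with rfl | ht
  · have h0 : ∫ x, f x ∂μ = 0 := le_antisymm (by simpa using h) (integral_nonneg hf0)
    rw [integral_eq_zero_iff_of_nonneg hf0 hf] at h0
    have hz : μ {x | 0 < f x} = 0 :=
      measure_mono_null (fun x hx => (ne_of_gt hx : f x ≠ 0)) (ae_iff.1 h0)
    rw [hz]; exact zero_le
  · have hM := mul_meas_ge_le_integral_of_nonneg (Filter.Eventually.of_forall hf0) hf t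
    have hp : μ.real {x | t ≤ f x} ≤ p :=
      le_of_mul_le_mul_left (by linarith [mul_comm p t]) ht
    calc μ {x | t < f x} ≤ μ {x | t ≤ f x} := measure_mono fun x hx => show t ≤ f x from le_of_lt hx
      _ = ENNReal.ofReal (μ.real {x | t ≤ f x}) := (ofReal_measureReal).symm
      _ ≤ _ := ENNReal.ofReal_le_ofReal hp

lemma meanSquareScale_nonneg (θ₀ : Fin n → ℝ) (P : Fin n → Measure (Sample N))
    (Q : Fin m → Measure (Sample N)) : 0 ≤ meanSquareScale θ₀ P Q := by
  have hP : 0 ≤ ∑ a, ∫ s, s.2 ^ 2 ∂(P a) :=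
    Finset.sum_nonneg fun _ _ => integral_nonneg fun _ => sq_nonneg _
  have hQ : 0 ≤ ∑ b, ∫ s, s.2 ^ 2 ∂(Q b) :=
    Finset.sum_nonneg fun _ _ => integral_nonneg fun _ => sq_nonneg _
  unfold meanSquareScale
  positivity

lemma measure_kernelDeviation_ge {P : Fin n → Measure (Sample N)}
    (hP : ∀ a, IsDesignSample (P a)) :
    (Measure.pi P) {S | ¬ kernelDeviation S < 1 / 4}
      ≤ ENNReal.ofReal (64 * ((n : ℝ) / 2 ^ N) ^ 2) := by
  have := fun a => (hP a).isProbabilityMeasure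
  -- the threshold `1 / 8 < 1 / 4` accounts for the strict inequality in the Markov bound
  refine (measure_mono fun S hS => ?_).trans (measure_lt_le_of_integral_le
    (integrable_kernelDeviation (P := P)) kernelDeviation_nonneg (t := 1 / 8) (by norm_num) ?_)
  · exact lt_of_lt_of_le (by norm_num) (not_lt.1 hS)
  · have := sq_nonneg ((n : ℝ) / 2 ^ N)
    linarith [integral_kernelDeviation_le hP]

/-! ### Expectations over both data sets -/

lemma abs_prediction_le (S : Fin n → Sample N) (θ : Fin n → ℝ) (ψ : PureState N) :
    |prediction S θ ψ| ≤ ∑ a, |θ a| := by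
  rw [prediction_eq]
  refine (Finset.abs_sum_le_sum_abs _ _).trans (Finset.sum_le_sum fun a _ => ?_)
  rw [abs_mul, abs_of_nonneg (kernel_nonneg _ _)]
  exact mul_le_of_le_one_right (abs_nonneg _) (kernel_le_one _ _)

section

variable {P : Fin n → Measure (Sample N)} {Q : Fin m → Measure (Sample N)}
  [∀ a, IsProbabilityMeasure (P a)] [∀ b, IsProbabilityMeasure (Q b)]

lemma integrable_trainLoss (hy : ∀ a, MemLp (fun s : Sample N => s.2) 2 (P a))
    (θ : Fin n → ℝ) : Integrable (fun S => trainLoss S θ) (Measure.pi P) := by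
  unfold trainLoss loss
  refine (integrable_finsetSum _ fun a _ => MemLp.integrable_sq
    (f := fun S : Fin n → Sample N => prediction S θ (S a).1 - (S a).2) ?_).const_mul _
  refine MemLp.sub (MemLp.of_bound (Continuous.aestronglyMeasurable (by fun_prop))
    (∑ a, |θ a|) (Filter.Eventually.of_forall fun S => abs_prediction_le _ _ _))
    (memLp_comp_eval (μ := P) (f := fun s => s.2) (hy a))

lemma integrable_loss_prod (hy : ∀ b, MemLp (fun s : Sample N => s.2) 2 (Q b))
    (θ : Fin n → ℝ) :
    Integrable (fun ω : (Fin n → Sample N) × (Fin m → Sample N) => loss ω.1 θ ω.2)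
      ((Measure.pi P).prod (Measure.pi Q)) := by
  unfold loss
  refine (integrable_finsetSum _ fun b _ => MemLp.integrable_sq
    (f := fun ω : (Fin n → Sample N) × (Fin m → Sample N) =>
      prediction ω.1 θ (ω.2 b).1 - (ω.2 b).2) ?_).const_mul _
  refine MemLp.sub (MemLp.of_bound (Continuous.aestronglyMeasurable (by fun_prop))
    (∑ a, |θ a|) (Filter.Eventually.of_forall fun S => abs_prediction_le _ _ _)) ?_
  exact (memLp_comp_eval (μ := Q) (f := fun s => s.2) (hy b)).comp_measurePreserving
    measurePreserving_snd

lemma integrable_sqrt_loss_prod (hyP : ∀ a, MemLp (fun s : Sample N => s.2) 2 (P a))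
    (hyQ : ∀ b, MemLp (fun s : Sample N => s.2) 2 (Q b)) (θ : Fin n → ℝ) :
    Integrable (fun ω : (Fin n → Sample N) × (Fin m → Sample N) =>
      √(trainLoss ω.1 θ * loss ω.1 θ ω.2)) ((Measure.pi P).prod (Measure.pi Q)) := by
  refine (((integrable_trainLoss hyP θ).comp_fst (Measure.pi Q)).add
    (integrable_loss_prod hyQ θ)).mono' (Continuous.aestronglyMeasurable ?_)
    (Filter.Eventually.of_forall fun ω => ?_)
  · unfold trainLoss
    fun_prop
  · rw [Real.norm_of_nonneg (Real.sqrt_nonneg _)]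
    exact sqrt_mul_le_add (loss_nonneg _ _ _) (loss_nonneg _ _ _)

end

lemma continuous_kernelMatrix :
    Continuous (kernelMatrix : (Fin n → Sample N) → Matrix (Fin n) (Fin n) ℝ) := by
  refine continuous_matrix fun a b => ?_
  simp only [kernelMatrix, Matrix.of_apply]
  fun_prop

lemma measurable_inv_mulVec : Measurable fun S : Fin n → Sample N =>
    (kernelMatrix S)⁻¹ *ᵥ fun a => (S a).2 := by
  refine measurable_pi_iff.2 fun a => ?_
  simp only [Matrix.inv_def, Ring.inverse_eq_inv', Matrix.mulVec, dotProduct, Matrix.smul_apply,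
    smul_eq_mul]
  refine Finset.measurable_sum _ fun b _ => Measurable.mul (Measurable.mul ?_ ?_) (by fun_prop)
  · have h : Continuous fun S : Fin n → Sample N => (kernelMatrix S).det :=
      continuous_kernelMatrix.matrix_det
    exact h.measurable.inv
  · have h : Continuous fun S : Fin n → Sample N => (kernelMatrix S).adjugate a b :=
      continuous_kernelMatrix.matrix_adjugate.matrix_elem a b
    exact h.measurable

lemma measurable_loss {θ : (Fin n → Sample N) → Fin n → ℝ} (hθ : Measurable θ) :
    Measurable fun ω : (Fin n → Sample N) × (Fin m → Sample N) => loss ω.1 (θ ω.1) ω.2 := by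
  unfold loss
  simp only [prediction_eq]
  refine (Finset.measurable_sum _ fun b _ => Measurable.pow_const (Measurable.sub
    (Finset.measurable_sum _ fun a _ => Measurable.mul (by fun_prop) ?_)
    (by fun_prop)) 2).const_mul _
  exact Continuous.measurable (by fun_prop)

/-- The lower integral over both data sets is reached through the measurable minorant that
vanishes unless the kernel matrix is close to the identity, in which case the trained parameter
is `k⁻¹ y`. -/
lemma ofReal_le_lintegral_loss {P : Fin n → Measure (Sample N)}
    {Q : Fin m → Measure (Sample N)} (hn : 0 < n) (hm : 0 < m) (hN : 0 < N)
    (hP : ∀ a, IsDesignSample (P a)) (hQ : ∀ b, IsDesignSample (Q b))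
    (hyP : ∀ a, MemLp (fun s : Sample N => s.2) 2 (P a))
    (hyQ : ∀ b, MemLp (fun s : Sample N => s.2) 2 (Q b))
    (θ₀ : Fin n → ℝ) {θinf : (Fin n → Sample N) → Fin n → ℝ}
    (hθ : ∀ S, kernelDeviation S < 1 / 4 →
      θinf S = (kernelMatrix S)⁻¹ *ᵥ fun a => (S a).2) :
    ENNReal.ofReal
        ((∫ ω, loss ω.1 θ₀ ω.2 ∂((Measure.pi P).prod (Measure.pi Q)))
          - (n : ℝ) / 2 ^ (N - 1) *
            (∫ ω, √(trainLoss ω.1 θ₀ * loss ω.1 θ₀ ω.2)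
              ∂((Measure.pi P).prod (Measure.pi Q)))
          - 64 * ((n : ℝ) / 2 ^ N) ^ 2 * meanSquareScale θ₀ P Q)
      ≤ ∫⁻ ω, ENNReal.ofReal (loss ω.1 (θinf ω.1) ω.2)
          ∂((Measure.pi P).prod (Measure.pi Q)) := by
  have := fun a => (hP a).isProbabilityMeasure
  have := fun b => (hQ b).isProbabilityMeasure
  have hl := integrable_loss_prod (P := P) hyQ θ₀
  have hs := integrable_sqrt_loss_prod hyP hyQ θ₀
  have hr := integrable_remainder hyP hyQ θ₀
  set J : (Fin n → Sample N) → ℝ := fun S => (∫ T, loss S θ₀ T ∂(Measure.pi Q))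
    - (n : ℝ) / 2 ^ (N - 1) * (∫ T, √(trainLoss S θ₀ * loss S θ₀ T) ∂(Measure.pi Q))
    - remainder θ₀ Q S with hJ
  have hls := hl.integral_prod_left
  have hss := hs.integral_prod_left.const_mul ((n : ℝ) / 2 ^ (N - 1))
  have hlss : Integrable (fun S => (∫ T, loss S θ₀ T ∂(Measure.pi Q)) - (n : ℝ) / 2 ^ (N - 1)
    * (∫ T, √(trainLoss S θ₀ * loss S θ₀ T) ∂(Measure.pi Q))) (Measure.pi P) := hls.sub hss
  have hJi : Integrable J (Measure.pi P) := hlss.sub hr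
  -- the measurable minorant of the final loss
  let g : (Fin n → Sample N) × (Fin m → Sample N) → ENNReal := fun ω =>
    if kernelDeviation ω.1 < 1 / 4 then
      ENNReal.ofReal (loss ω.1 ((kernelMatrix ω.1)⁻¹ *ᵥ fun a => (ω.1 a).2) ω.2) else 0
  have hg : Measurable g := by
    refine Measurable.ite ?_ (measurable_loss measurable_inv_mulVec).ennreal_ofReal measurable_const
    exact (isOpen_lt (continuous_kernelDeviation.comp continuous_fst)
      continuous_const).measurableSet
  calc _ ≤ ENNReal.ofReal (∫ S, J S ∂(Measure.pi P)) := by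
        refine ENNReal.ofReal_le_ofReal ?_
        simp only [hJ]
        rw [integral_sub hlss hr, integral_sub hls hss, integral_const_mul, integral_prod _ hl,
          integral_prod _ hs]
        linarith [integral_remainder_le hn hP hQ hyP hyQ θ₀]
    _ ≤ ∫⁻ S, ENNReal.ofReal (J S) ∂(Measure.pi P) := by
        calc _ ≤ ENNReal.ofReal (∫ S, max (J S) 0 ∂(Measure.pi P)) :=
              ENNReal.ofReal_le_ofReal
                (integral_mono hJi hJi.pos_part fun S => le_max_left _ _)
          _ = ∫⁻ S, ENNReal.ofReal (max (J S) 0) ∂(Measure.pi P) :=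
              ofReal_integral_eq_lintegral_ofReal hJi.pos_part
                (Filter.Eventually.of_forall fun S => le_max_right _ _)
          _ = _ := by simp [ENNReal.ofReal_max]
    _ ≤ ∫⁻ S, ∫⁻ T, g (S, T) ∂(Measure.pi Q) ∂(Measure.pi P) := by
        refine lintegral_mono fun S => ?_
        rcases lt_or_ge (kernelDeviation S) (1 / 4) with hS | hS
        · simp only [g, hS, if_true]
          rw [← ofReal_integral_eq_lintegral_ofReal (integrable_loss hyQ S _)
            (Filter.Eventually.of_forall fun T => loss_nonneg _ _ _)]
          exact ENNReal.ofReal_le_ofReal (integral_loss_ge hn hm hN hQ hyQ θ₀ hS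
            ((trainLoss_eq_zero_iff hn _ _).1
              (trainLoss_inv_mulVec hn (isUnit_det_kernelMatrix hS))))
        · have hJ0 : J S ≤ 0 := by
            have h1 := integral_loss_le_remainder hm hQ hyQ θ₀ hS
            have h2 : 0 ≤ (n : ℝ) / 2 ^ (N - 1)
                * (∫ T, √(trainLoss S θ₀ * loss S θ₀ T) ∂(Measure.pi Q)) :=
              mul_nonneg (by positivity) (integral_nonneg fun T => Real.sqrt_nonneg _)
            simp only [hJ]
            linarith
          rw [ENNReal.ofReal_of_nonpos hJ0]
          exact zero_le
    _ = ∫⁻ ω, g ω ∂((Measure.pi P).prod (Measure.pi Q)) :=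
        (lintegral_prod _ hg.aemeasurable).symm
    _ ≤ _ := by
        refine lintegral_mono fun ω => ?_
        simp only [g]
        split_ifs with hS
        · rw [hθ ω.1 hS]
        · exact zero_le

/-- Markov's inequality for the remainder. -/
lemma measure_integral_loss_lt_le {P : Fin n → Measure (Sample N)}
    {Q : Fin m → Measure (Sample N)} (hn : 0 < n) (hm : 0 < m) (hN : 0 < N)
    (hP : ∀ a, IsDesignSample (P a)) (hQ : ∀ b, IsDesignSample (Q b))
    (hyP : ∀ a, MemLp (fun s : Sample N => s.2) 2 (P a))
    (hyQ : ∀ b, MemLp (fun s : Sample N => s.2) 2 (Q b))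
    (θ₀ : Fin n → ℝ) {θinf : (Fin n → Sample N) → Fin n → ℝ}
    (hθ : ∀ S, kernelDeviation S < 1 / 4 → kernelMatrix S *ᵥ θinf S = fun a => (S a).2)
    {p : ℝ} (hp : 0 < p) :
    (Measure.pi P)
        {S | ¬ ((∫ T, loss S θ₀ T ∂(Measure.pi Q))
            - (n : ℝ) / 2 ^ (N - 1) *
              (∫ T, √(trainLoss S θ₀ * loss S θ₀ T) ∂(Measure.pi Q))
            - 64 / p * ((n : ℝ) / 2 ^ N) ^ 2 * meanSquareScale θ₀ P Q
          ≤ ∫ T, loss S (θinf S) T ∂(Measure.pi Q))}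
      ≤ ENNReal.ofReal p := by
  have := fun a => (hP a).isProbabilityMeasure
  have := fun b => (hQ b).isProbabilityMeasure
  have hM := meanSquareScale_nonneg θ₀ P Q
  refine (measure_mono fun S hS => ?_).trans (measure_lt_le_of_integral_le
    (integrable_remainder hyP hyQ θ₀) (remainder_nonneg θ₀ Q)
    (t := 64 / p * ((n : ℝ) / 2 ^ N) ^ 2 * meanSquareScale θ₀ P Q) (by positivity) ?_)
  · rw [Set.mem_ofPred_eq, not_le] at hS
    rw [Set.mem_ofPred_eq]
    rcases lt_or_ge (kernelDeviation S) (1 / 4) with h | h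
    · linarith [integral_loss_ge hn hm hN hQ hyQ θ₀ h (hθ S h)]
    · have h1 := integral_loss_le_remainder hm hQ hyQ θ₀ h
      have h2 : 0 ≤ (n : ℝ) / 2 ^ (N - 1)
          * (∫ T, √(trainLoss S θ₀ * loss S θ₀ T) ∂(Measure.pi Q)) :=
        mul_nonneg (by positivity) (integral_nonneg fun T => Real.sqrt_nonneg _)
      have h3 : 0 ≤ ∫ T, loss S (θinf S) T ∂(Measure.pi Q) :=
        integral_nonneg fun T => loss_nonneg _ _ _
      linarith
  · refine (integral_remainder_le hn hP hQ hyP hyQ θ₀).trans (le_of_eq ?_)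
    field_simp

end QKM

theorem mainTheorem1 :
    ∃ C : ℝ, 0 < C ∧
      ∀ (N n m : ℕ), 0 < n → 0 < m → (n : ℝ) < (2 : ℝ) ^ ((N : ℝ) / 2) →
      -- laws of the training samples and of the test samples
      ∀ (P : Fin n → Measure (QKM.Sample N)) (Q : Fin m → Measure (QKM.Sample N))
        [∀ a, IsProbabilityMeasure (P a)] [∀ b, IsProbabilityMeasure (Q b)],
      (∀ a, QKM.IsStateTwoDesign ((P a).map Prod.fst)) →
      (∀ b, QKM.IsStateTwoDesign ((Q b).map Prod.fst)) →
      (∀ a, MemLp (fun s : QKM.Sample N => s.2) 2 (P a)) →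
      (∀ b, MemLp (fun s : QKM.Sample N => s.2) 2 (Q b)) →
      -- the initial parameter and the parameter after training
      ∀ (θ₀ : Fin n → ℝ) (θinf : (Fin n → QKM.Sample N) → Fin n → ℝ),
      (∀ S, (∃ θ, QKM.trainLoss S θ = 0) → QKM.trainLoss S (θinf S) = 0) →
      -- with high probability the training reaches zero training loss
      (Measure.pi P)
          {S | ¬ (IsUnit (QKM.kernelMatrix S).det ∧
            θinf S = (QKM.kernelMatrix S)⁻¹ *ᵥ (fun a => (S a).2) ∧
            QKM.trainLoss S (θinf S) = 0)}
        ≤ ENNReal.ofReal (C * ((n : ℝ) / 2 ^ N) ^ 2) ∧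
      -- the bound for the expectations over both data sets
      (Integrable (fun ω : (Fin n → QKM.Sample N) × (Fin m → QKM.Sample N) =>
          QKM.loss ω.1 θ₀ ω.2) ((Measure.pi P).prod (Measure.pi Q)) ∧
        Integrable (fun ω : (Fin n → QKM.Sample N) × (Fin m → QKM.Sample N) =>
          √(QKM.trainLoss ω.1 θ₀ * QKM.loss ω.1 θ₀ ω.2))
          ((Measure.pi P).prod (Measure.pi Q)) ∧
        ENNReal.ofReal
            ((∫ ω, QKM.loss ω.1 θ₀ ω.2 ∂((Measure.pi P).prod (Measure.pi Q)))
              - (n : ℝ) / 2 ^ (N - 1) *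
                (∫ ω, √(QKM.trainLoss ω.1 θ₀ * QKM.loss ω.1 θ₀ ω.2)
                  ∂((Measure.pi P).prod (Measure.pi Q)))
              - C * ((n : ℝ) / 2 ^ N) ^ 2 * QKM.meanSquareScale θ₀ P Q)
          ≤ ∫⁻ ω, ENNReal.ofReal (QKM.loss ω.1 (θinf ω.1) ω.2)
              ∂((Measure.pi P).prod (Measure.pi Q))) ∧
      -- the bound with high probability over the training set,
      -- with the expectations over the test set
      (∀ p : ℝ, 0 < p →
        (Measure.pi P)
            {S | ¬ ((∫ T, QKM.loss S θ₀ T ∂(Measure.pi Q))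
                - (n : ℝ) / 2 ^ (N - 1) *
                  (∫ T, √(QKM.trainLoss S θ₀ * QKM.loss S θ₀ T) ∂(Measure.pi Q))
                - C / p * ((n : ℝ) / 2 ^ N) ^ 2 * QKM.meanSquareScale θ₀ P Q
              ≤ ∫ T, QKM.loss S (θinf S) T ∂(Measure.pi Q))}
          ≤ ENNReal.ofReal p) := by
  -- the constant of `integral_remainder_le`, which also exceeds the `8` needed for `k`
  refine ⟨64, by norm_num, ?_⟩
  intro N n m hn hm hnN P Q _ _ hP hQ hyP hyQ θ₀ θinf hθinf
  have hN : 0 < N := by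
    rcases N.eq_zero_or_pos with rfl | h
    · have h1 : (1 : ℝ) ≤ n := by exact_mod_cast hn
      norm_num at hnN
      omega
    · exact h
  have htrain : ∀ S, QKM.kernelDeviation S < 1 / 4 → QKM.trainLoss S (θinf S) = 0 :=
    fun S hS => hθinf S
      ⟨_, QKM.trainLoss_inv_mulVec hn (QKM.isUnit_det_kernelMatrix hS)⟩
  have hinv : ∀ S, QKM.kernelDeviation S < 1 / 4 →
      θinf S = (QKM.kernelMatrix S)⁻¹ *ᵥ fun a => (S a).2 := fun S hS =>
    QKM.eq_inv_mulVec_of_trainLoss_eq_zero hn (QKM.isUnit_det_kernelMatrix hS) (htrain S hS)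
  refine ⟨?_, ⟨QKM.integrable_loss_prod hyQ θ₀, QKM.integrable_sqrt_loss_prod hyP hyQ θ₀,
    QKM.ofReal_le_lintegral_loss hn hm hN hP hQ hyP hyQ θ₀ hinv⟩, fun p hp =>
    QKM.measure_integral_loss_lt_le hn hm hN hP hQ hyP hyQ θ₀
      (fun S hS => (QKM.trainLoss_eq_zero_iff hn _ _).1 (htrain S hS)) hp⟩
  refine (measure_mono fun S hS => ?_).trans (QKM.measure_kernelDeviation_ge hP)
  exact fun h => hS ⟨QKM.isUnit_det_kernelMatrix h, hinv S h, htrain S h⟩
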